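/- For $m,n\in\mathbb{N}=\{1,2,\dots\}$ let $N^{(s)}(m,n)$ denote the number of subrings of the ring $\mathbb{Z}_m\times\mathbb{Z}_n$, where a subring is an additive subgroup closed under multiplication (it need not contain the identity element). Let $\tau(n)$ be the number of positive divisors of $n$, let $C$ be Euler's constant, and let $\theta$ be the exponent in the Dirichlet divisor problem, that is, the smallest real number such that $$\sum_{n\le x}\tau(n)=x\log x+(2C-1)x+O(x^{\theta+\varepsilon})\qquad(x\to\infty)$$ for every $\varepsilon>0$. Let $\zeta$ be the Riemann zeta function. (i) For all $z,w\in\mathbb{C}$ with $\Re z>1$ and $\Re w>1$, the following double series converges absolutely and $$\sum_{m,n=1}^{\infty}\frac{N^{(s)}(m,n)}{m^z n^w}=\frac{\zeta^2(z)\,\zeta^2(w)\,\zeta(z+w)\,\zeta(2z+2w-1)}{\zeta(z+2w)\,\zeta(2z+w)}.$$ (ii) Let $A_1=\zeta(2)/\zeta(3)$. There are real constants $A_2,A_3$ such that for every $\varepsilon>0$, $$\sum_{m,n\le x}N^{(s)}(m,n)=x^2\left(A_1\log^2x+A_2\log x+A_3\right)+O(x^{1+\theta+\varepsilon})\qquad(x\to\infty),$$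 where the implied constant may depend on $\varepsilon$. -/

import Mathlib

open Filter Asymptotics

/-- The number of subrings of `ℤ_m × ℤ_n` (for `m, n ≥ 1`). A subring is a subset containing `0` and
closed under subtraction and multiplication; it need not contain the identity. -/
noncomputable def numSubrings (m n : ℕ) : ℕ :=
  Nat.card (NonUnitalSubring (ZMod m × ZMod n))

/-- The error term `Δ(x) = ∑_{n ≤ x} τ(n) - (x log x + (2C - 1) x)` of the Dirichlet divisor problem,
where `τ(n)` is the number of positive divisors of `n` and `C` is Euler's constant. -/
noncomputable def divisorError (x : ℝ) : ℝ :=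
  (∑ n ∈ Finset.Icc 1 ⌊x⌋₊, (n.divisors.card : ℝ)) -
    (x * Real.log x + (2 * Real.eulerMascheroniConstant - 1) * x)

/-- `θ` is admissible if `Δ(x) = O(x^(θ + ε))` as `x → ∞`, for every `ε > 0`. -/
def IsDivisorAdmissible (θ : ℝ) : Prop :=
  ∀ ε : ℝ, 0 < ε → divisorError =O[atTop] fun x : ℝ => x ^ (θ + ε)

/-- The exponent of the Dirichlet divisor problem: the smallest admissible `θ`. -/
noncomputable def divisorExponent : ℝ :=
  sInf {θ : ℝ | IsDivisorAdmissible θ}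

/-! Subrings of `ℤ_m × ℤ_n` correspond to the lattices in `ℤ²` that contain `mℤ × nℤ` and are closed
under multiplication. Such a lattice has a unique Hermite basis `(a, s)`, `(0, b)` with `0 ≤ s < b`.
Containing `(m, 0)` and `(0, n)` means `a ∣ m`, `b ∣ n`, `b ∣ (m / a) s`; closure amounts to `b ∣ s
(s - a)`, since `(a, s)² - a (a, s) = (0, s (s - a))`.

Removing `gcd(s, b)` from `s` turns the count of `s` into counts of units `s'` modulo `e` with `g s'
≡ a`, which Möbius inversion evaluates. After gcds are extracted and the Möbius factors regrouped,
everything collapses to (`numSubrings_eq_sum_weight`) `N(m, n) = ∑ l μ(u) μ(v) τ(m / r) τ(n / s)`,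
with `r = k l² u v²`, `s = k l² u² v`, over the quadruples `(k, l, u, v)` with `r ∣ m`, `s ∣ n`.

(i) The two `τ` give `ζ²(z) ζ²(w)`. The weights give a product of four one-variable series in `k, l,
u, v`, absolutely convergent as soon as `Re z, Re w > 0` and `Re (z + w) > 1` (`hasSum_weight`).

(ii) With `D(x) = ∑_{n ≤ x} τ(n) = M(x) + Δ(x)`, the double sum is `∑ l μ(u) μ(v) D(x / r) D(x /
s)`. The products `M M` give `x²` times a quadratic in `log x`, with leading coefficient the weight
series at `(1, 1)`, namely `ζ(2) / ζ(3)`. Each remaining product contains a `Δ`. Since the weight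
series converges at `(β, 1 ± δ)` with `β` just above `θ` and `δ < β`, bounds for `M`, `D` and `Δ`
valid on all of `[0, ∞)` can be summed over every quadruple without truncation (`isBigO_error`). -/

/-! ### Subrings as lattices in Hermite form -/

section SubringCount

/-- The subring of `ℤ_m × ℤ_n` that is the image of the lattice spanned by `(a, s)` and `(0, b)`. -/
def latticeSubring (m n a b s : ℕ) (h : (b : ℤ) ∣ s * (s - a)) :
    NonUnitalSubring (ZMod m × ZMod n) where
  carrier := {p | ∃ i j : ℤ, p = (((a * i : ℤ) : ZMod m), ((s * i + b * j : ℤ) : ZMod n))}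
  zero_mem' := ⟨0, 0, by simp; rfl⟩
  add_mem' := by
    rintro _ _ ⟨i, j, rfl⟩ ⟨i', j', rfl⟩
    refine ⟨i + i', j + j', Prod.ext ?_ ?_⟩ <;> simp only [Prod.mk_add_mk] <;>
      push_cast <;> ring
  neg_mem' := by
    rintro _ ⟨i, j, rfl⟩
    refine ⟨-i, -j, Prod.ext ?_ ?_⟩ <;> simp
    ring
  mul_mem' := by
    rintro _ _ ⟨i, j, rfl⟩ ⟨i', j', rfl⟩
    obtain ⟨c, hc⟩ := h
    -- From `s² = a s + b c`, the product of second coordinates is `s (a i i')` plus a multiple of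
    -- `b`.
    refine ⟨a * i * i', c * i * i' + s * i * j' + s * j * i' + b * j * j', Prod.ext ?_ ?_⟩
    · simp only [Prod.mk_mul_mk]; push_cast; ring
    · simp only [Prod.mk_mul_mk, ← Int.cast_mul]
      congr 1
      linear_combination (i * i') * hc

/-- The hypotheses put `(m, 0)` and `(0, n)` in the lattice, so membership modulo `(m, n)` lifts to
`ℤ²`. -/
lemma mem_latticeSubring {m n a b s : ℕ} (h : (b : ℤ) ∣ s * (s - a)) (ha : a ∣ m) (hb : b ∣ n)
    (hs : b ∣ m / a * s) (X Y : ℤ) :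
    ((X : ZMod m), (Y : ZMod n)) ∈ latticeSubring m n a b s h ↔
      ∃ i j : ℤ, X = a * i ∧ Y = s * i + b * j := by
  constructor
  · rintro ⟨i, j, hij⟩
    obtain ⟨h1, h2⟩ := Prod.ext_iff.1 hij
    simp only [ZMod.intCast_eq_intCast_iff_dvd_sub] at h1 h2
    obtain ⟨t, ht⟩ := h1
    obtain ⟨t', ht'⟩ := h2
    -- If `a = 0` then `m = 0` and `ZMod m` is `ℤ`, so the first congruence is an equality.
    rcases Nat.eq_zero_or_pos a with rfl | ha0
    · obtain rfl : m = 0 := by simpa using ha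
      obtain ⟨d, rfl⟩ := hb
      refine ⟨i, j - d * t', by push_cast at *; linarith, by push_cast at *; linarith⟩
    obtain ⟨c, rfl⟩ := ha
    obtain ⟨d, rfl⟩ := hb
    rw [Nat.mul_div_cancel_left _ ha0] at hs
    obtain ⟨e, he⟩ := hs
    have he' : (c : ℤ) * s = b * e := by exact_mod_cast he
    refine ⟨i - c * t, j - d * t' + e * t, ?_, ?_⟩
    · push_cast at ht; linear_combination -ht
    · push_cast at ht'; linear_combination -ht' + t * he'
  · rintro ⟨i, j, rfl, rfl⟩
    exact ⟨i, j, rfl⟩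

lemma exists_nat_generator (H : AddSubgroup ℤ) : ∃ a : ℕ, ∀ x, x ∈ H ↔ (a : ℤ) ∣ x := by
  obtain ⟨a, rfl⟩ := Int.subgroup_cyclic H
  refine ⟨a.natAbs, fun x => ?_⟩
  rw [AddSubgroup.mem_closure_singleton, Int.natAbs_dvd, dvd_iff_exists_eq_mul_left]
  simp [eq_comm]

/-- In the preimage `L` of `S` in `ℤ²`, `a` generates the first projection, `b` generates the fibre
over `0`, and `s` is the second coordinate of a point over `a`, reduced modulo `b`. -/
lemma exists_eq_latticeSubring {m n : ℕ} (hm : 0 < m) (hn : 0 < n)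
    (S : NonUnitalSubring (ZMod m × ZMod n)) :
    ∃ a b s : ℕ, a ∣ m ∧ b ∣ n ∧ s < b ∧ b ∣ m / a * s ∧
      ∃ h : (b : ℤ) ∣ s * (s - a), latticeSubring m n a b s h = S := by
  let φ : ℤ × ℤ →+ ZMod m × ZMod n :=
    (Int.castAddHom (ZMod m)).prodMap (Int.castAddHom (ZMod n))
  let L : AddSubgroup (ℤ × ℤ) := S.toAddSubgroup.comap φ
  have hL : ∀ X Y : ℤ, (X, Y) ∈ L ↔ ((X : ZMod m), (Y : ZMod n)) ∈ S := fun X Y => Iff.rfl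
  obtain ⟨a, ha⟩ := exists_nat_generator (L.map (AddMonoidHom.fst ℤ ℤ))
  obtain ⟨b, hb⟩ := exists_nat_generator (L.comap (AddMonoidHom.inr ℤ ℤ))
  have ha' : ∀ X Y : ℤ, (X, Y) ∈ L → (a : ℤ) ∣ X := fun X Y h => (ha X).1 ⟨(X, Y), h, rfl⟩
  have hb' : ∀ Y : ℤ, (0, Y) ∈ L ↔ (b : ℤ) ∣ Y := fun Y => hb Y
  have hmL : ((m : ℤ), (0 : ℤ)) ∈ L := by
    rw [hL]; convert S.zero_mem <;> simp
  have hnL : ((0 : ℤ), (n : ℤ)) ∈ L := by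
    rw [hL]; convert S.zero_mem <;> simp
  have ham : a ∣ m := Int.natCast_dvd_natCast.1 (ha' _ _ hmL)
  have hbn : b ∣ n := Int.natCast_dvd_natCast.1 ((hb' _).1 hnL)
  have ha0 : 0 < a := Nat.pos_of_dvd_of_pos ham hm
  have hb0 : 0 < b := Nat.pos_of_dvd_of_pos hbn hn
  obtain ⟨⟨X, Y⟩, hXY, hX⟩ := (ha a).2 dvd_rfl
  obtain rfl : X = a := hX
  have hbL : ∀ j : ℤ, ((0 : ℤ), (b : ℤ) * j) ∈ L := fun j => (hb' _).2 (dvd_mul_right _ _)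
  obtain ⟨s, hs⟩ := Int.eq_ofNat_of_zero_le (Int.emod_nonneg Y (by exact_mod_cast hb0.ne' : (b : ℤ) ≠ 0))
  have hsb : s < b := by
    have := Int.emod_lt_of_pos Y (by exact_mod_cast hb0 : (0 : ℤ) < b)
    omega
  have hsL : ((a : ℤ), (s : ℤ)) ∈ L := by
    have := L.sub_mem hXY (hbL (Y / b))
    rw [Prod.mk_sub_mk] at this
    convert this using 2
    · simp
    · have := Int.emod_add_mul_ediv Y b
      linarith
  have hsmul : ∀ i j : ℤ, ((a : ℤ) * i, (s : ℤ) * i + b * j) ∈ L := by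
    intro i j
    have := L.add_mem (L.zsmul_mem hsL i) (hbL j)
    convert this using 1
    ext <;> simp <;> ring
  have hsq : (b : ℤ) ∣ s * (s - a) := by
    rw [← hb']
    have h1 : ((a : ℤ) * a, (s : ℤ) * s) ∈ L := by
      rw [hL] at hsL ⊢
      simpa using S.mul_mem hsL hsL
    have := L.sub_mem h1 (hsmul a 0)
    convert this using 1
    ext <;> simp; ring
  refine ⟨a, b, s, ham, hbn, hsb, ?_, hsq, ?_⟩
  · obtain ⟨c, rfl⟩ := ham
    rw [Nat.mul_div_cancel_left _ ha0]
    rw [← Int.natCast_dvd_natCast, ← hb']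
    have := L.sub_mem (hsmul c 0) hmL
    convert this using 1
    ext <;> simp; ring
  · ext ⟨x, y⟩
    constructor
    · rintro ⟨i, j, hij⟩
      rw [hij]
      exact (hL _ _).1 (hsmul i j)
    · intro hxy
      obtain ⟨X, rfl⟩ := ZMod.intCast_surjective x
      obtain ⟨Y', rfl⟩ := ZMod.intCast_surjective y
      have hXY' : (X, Y') ∈ L := hxy
      obtain ⟨i, rfl⟩ := ha' _ _ hXY'
      have := L.sub_mem hXY' (hsmul i 0)
      rw [Prod.mk_sub_mk, sub_self, hb'] at this
      obtain ⟨j, hj⟩ := this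
      exact ⟨i, j, Prod.ext rfl (congrArg (Int.cast : ℤ → ZMod n) (by linarith))⟩

/-- Uniqueness of the Hermite form: mutual divisibility fixes `a` and `b`, and then `s` is fixed
modulo `b`. -/
lemma latticeSubring_injective {m n a b s a' b' s' : ℕ} (hm : 0 < m)
    (h : (b : ℤ) ∣ s * (s - a)) (ha : a ∣ m) (hb : b ∣ n) (hs : b ∣ m / a * s) (hsb : s < b)
    (h' : (b' : ℤ) ∣ s' * (s' - a')) (ha' : a' ∣ m) (hb' : b' ∣ n) (hs' : b' ∣ m / a' * s')
    (hsb' : s' < b') (heq : latticeSubring m n a b s h = latticeSubring m n a' b' s' h') :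
    a = a' ∧ b = b' ∧ s = s' := by
  have key : ∀ X Y : ℤ, (∃ i j : ℤ, X = a * i ∧ Y = s * i + b * j) ↔
      ∃ i j : ℤ, X = a' * i ∧ Y = s' * i + b' * j := fun X Y => by
    rw [← mem_latticeSubring h ha hb hs, ← mem_latticeSubring h' ha' hb' hs', heq]
  have ha0 : (a : ℤ) ≠ 0 := by exact_mod_cast (Nat.pos_of_dvd_of_pos ha hm).ne'
  have ha0' : (a' : ℤ) ≠ 0 := by exact_mod_cast (Nat.pos_of_dvd_of_pos ha' hm).ne'
  obtain ⟨i, j, h1, h2⟩ := (key a s).1 ⟨1, 0, by ring, by ring⟩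
  obtain ⟨i', j', h1', h2'⟩ := (key a' s').2 ⟨1, 0, by ring, by ring⟩
  obtain rfl : a = a' := Nat.dvd_antisymm (Int.natCast_dvd_natCast.1 ⟨i', h1'⟩)
    (Int.natCast_dvd_natCast.1 ⟨i, h1⟩)
  obtain ⟨i₂, j₂, h3, h4⟩ := (key 0 b).1 ⟨0, 1, by ring, by ring⟩
  obtain ⟨i₃, j₃, h5, h6⟩ := (key 0 b').2 ⟨0, 1, by ring, by ring⟩
  obtain rfl : i₂ = 0 := (mul_eq_zero.1 h3.symm).resolve_left ha0
  obtain rfl : i₃ = 0 := (mul_eq_zero.1 h5.symm).resolve_left ha0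
  obtain rfl : b = b' := Nat.dvd_antisymm (Int.natCast_dvd_natCast.1 ⟨j₃, by linarith⟩)
    (Int.natCast_dvd_natCast.1 ⟨j₂, by linarith⟩)
  refine ⟨rfl, rfl, ?_⟩
  obtain rfl : i = 1 := mul_left_cancel₀ ha0 (by linarith)
  have : (s : ℤ) % b = s' % b := by rw [h2]; simp
  rw [Int.emod_eq_of_lt (by positivity) (by exact_mod_cast hsb),
    Int.emod_eq_of_lt (by positivity) (by exact_mod_cast hsb')] at this
  exact_mod_cast this

theorem numSubrings_eq_sum_card {m n : ℕ} (hm : 0 < m) (hn : 0 < n) :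
    numSubrings m n = ∑ a ∈ m.divisors, ∑ b ∈ n.divisors,
      ((Finset.range b).filter fun s => b ∣ m / a * s ∧ (b : ℤ) ∣ s * (s - a)).card := by
  classical
  let T : Finset (Σ _ : ℕ, Σ _ : ℕ, ℕ) := m.divisors.sigma fun a => n.divisors.sigma fun b =>
    (Finset.range b).filter fun s => b ∣ m / a * s ∧ (b : ℤ) ∣ s * (s - a)
  have hT : ∀ t : Σ _ : ℕ, Σ _ : ℕ, ℕ, t ∈ T ↔ t.1 ∣ m ∧ t.2.1 ∣ n ∧ t.2.2 < t.2.1 ∧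
      t.2.1 ∣ m / t.1 * t.2.2 ∧ (t.2.1 : ℤ) ∣ t.2.2 * (t.2.2 - t.1) := by
    intro t
    simp [T, hm.ne', hn.ne']
  have hcard : T.card = ∑ a ∈ m.divisors, ∑ b ∈ n.divisors,
      ((Finset.range b).filter fun s => b ∣ m / a * s ∧ (b : ℤ) ∣ s * (s - a)).card := by
    simp [T, Finset.card_sigma]
  let F : T → NonUnitalSubring (ZMod m × ZMod n) := fun t =>
    latticeSubring m n t.1.1 t.1.2.1 t.1.2.2 ((hT t.1).1 t.2).2.2.2.2
  have hF : F.Bijective := by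
    constructor
    · rintro ⟨⟨a, b, s⟩, ht⟩ ⟨⟨a', b', s'⟩, ht'⟩ heq
      obtain ⟨h1, h2, h3, h4, h5⟩ := (hT _).1 ht
      obtain ⟨h1', h2', h3', h4', h5'⟩ := (hT _).1 ht'
      obtain ⟨rfl, rfl, rfl⟩ :=
        latticeSubring_injective hm h5 h1 h2 h4 h3 h5' h1' h2' h4' h3' heq
      rfl
    · intro S
      obtain ⟨a, b, s, h1, h2, h3, h4, h5, rfl⟩ := exists_eq_latticeSubring hm hn S
      exact ⟨⟨⟨a, b, s⟩, (hT _).2 ⟨h1, h2, h3, h4, h5⟩⟩, rfl⟩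
  rw [← hcard, numSubrings, ← Nat.card_eq_of_bijective F hF, Nat.card_eq_fintype_card,
    Fintype.card_coe]

end SubringCount

/-! ### Reduction to counting units in residue classes -/

section Arithmetic

open ArithmeticFunction Finset
open scoped ArithmeticFunction.Moebius

lemma sum_divisors_moebius (n : ℕ) :
    ∑ d ∈ n.divisors, μ d = if n = 1 then 1 else 0 := by
  have h := congrArg (fun f : ArithmeticFunction ℤ => f n) moebius_mul_coe_zeta
  simpa only [coe_mul_zeta_apply, one_apply] using h

lemma sum_divisors_dvd_moebius {a b : ℕ} (ha : a ≠ 0) :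
    ∑ d ∈ a.divisors with d ∣ b, μ d = if a.Coprime b then 1 else 0 := by
  have hg : a.gcd b ≠ 0 := Nat.gcd_ne_zero_left ha
  rw [show (a.divisors.filter (· ∣ b)) = (a.gcd b).divisors by
    ext d; simp [ha, hg, Nat.dvd_gcd_iff], sum_divisors_moebius]

/-- The number of units `s` modulo `e` with `g s ≡ a` modulo `e`. -/
def unitCount (e a g : ℕ) : ℕ :=
  ((range e).filter fun s : ℕ => s.Coprime e ∧ (e : ℤ) ∣ g * s - a).card

/-- Sort by `g = gcd(s, b)`: with `b = g e` and `s = g s'`, `s'` is a unit modulo `e`. So `b ∣ c s`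
becomes `e ∣ c`, and `b ∣ s (s - a)` becomes `e ∣ g s' - a`. -/
lemma card_filter_eq_sum_unitCount {b : ℕ} (hb : 0 < b) (a c : ℕ) :
    ((range b).filter fun s => b ∣ c * s ∧ (b : ℤ) ∣ s * (s - a)).card =
      ∑ e ∈ b.divisors with e ∣ c, unitCount e a (b / e) := by
  simp only [unitCount]
  rw [← card_sigma]
  symm
  refine card_bij (fun t _ => b / t.1 * t.2) ?_ ?_ ?_
  · rintro ⟨e, s⟩ h
    simp only [mem_sigma, mem_filter, Nat.mem_divisors, mem_range] at h ⊢
    obtain ⟨⟨⟨⟨g, rfl⟩, -⟩, hec⟩, hs, hcop, hdvd⟩ := h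
    have he : 0 < e := Nat.pos_of_mul_pos_right hb
    have hg : 0 < g := Nat.pos_of_mul_pos_left hb
    rw [Nat.mul_div_cancel_left _ he] at hdvd ⊢
    refine ⟨by rw [mul_comm e]; exact Nat.mul_lt_mul_of_pos_left hs hg, ?_, ?_⟩
    · obtain ⟨d, rfl⟩ := hec
      exact ⟨d * s, by ring⟩
    · obtain ⟨d, hd⟩ := hdvd
      exact ⟨s * d, by push_cast; rw [hd]; ring⟩
  · rintro ⟨e, s⟩ h ⟨e', s'⟩ h' heq
    simp only [mem_sigma, mem_filter, Nat.mem_divisors, mem_range] at h h' heq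
    obtain ⟨⟨⟨heb, -⟩, hec⟩, hs, hcop, hdvd⟩ := h
    obtain ⟨⟨⟨heb', -⟩, hec'⟩, hs', hcop', hdvd'⟩ := h'
    have key : ∀ e s : ℕ, e ∣ b → s.Coprime e → (b / e * s).gcd b = b / e := by
      intro e s he hs
      conv_lhs => rw [← Nat.div_mul_cancel he]
      rw [Nat.mul_div_cancel _ (Nat.pos_of_dvd_of_pos he hb), Nat.gcd_mul_left, hs.gcd_eq_one,
        mul_one]
    have h1 : b / e = b / e' := by
      rw [← key e s heb hcop, ← key e' s' heb' hcop', heq]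
    have hpos : 0 < b / e := Nat.div_pos (Nat.le_of_dvd hb heb) (Nat.pos_of_dvd_of_pos heb hb)
    obtain rfl : e = e' := by
      rw [← Nat.div_div_self heb hb.ne', h1, Nat.div_div_self heb' hb.ne']
    obtain rfl : s = s' := Nat.eq_of_mul_eq_mul_left hpos heq
    rfl
  · intro s h
    simp only [mem_filter, mem_range] at h
    obtain ⟨hs, h1, h2⟩ := h
    have hg : 0 < s.gcd b := Nat.gcd_pos_of_pos_right _ hb
    obtain ⟨g, s', e, hg', hcop, hs', hb'⟩ := Nat.exists_coprime' hg
    obtain rfl := hb'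
    obtain rfl := hs'
    have hg0 : 0 < g := Nat.pos_of_mul_pos_left hb
    have he0 : 0 < e := Nat.pos_of_mul_pos_right hb
    refine ⟨⟨e, s'⟩, ?_, ?_⟩
    · simp only [mem_sigma, mem_filter, Nat.mem_divisors, mem_range]
      rw [Nat.mul_div_cancel_left _ he0]
      refine ⟨⟨⟨dvd_mul_right _ _, hb.ne'⟩, ?_⟩, lt_of_mul_lt_mul_right hs (Nat.zero_le _), hcop, ?_⟩
      · rw [← mul_assoc] at h1
        exact hcop.symm.dvd_of_dvd_mul_right (Nat.dvd_of_mul_dvd_mul_right hg0 h1)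
      · have h3 : (e : ℤ) ∣ s' * (g * s' - a) := by
          apply Int.dvd_of_mul_dvd_mul_right (a := (g : ℤ)) (by exact_mod_cast hg0.ne')
          convert h2 using 1 <;> push_cast <;> ring
        exact (Nat.isCoprime_iff_coprime.2 hcop.symm).dvd_of_dvd_mul_left h3
    · simp only
      rw [Nat.mul_div_cancel_left _ he0, mul_comm]

/-- The substitution `A = a e`, which makes the count symmetric in the two factors. -/
lemma sum_divisors_sum_dvd_div {M : Type*} [AddCommMonoid M] {m : ℕ} (hm : 0 < m) (E : Finset ℕ)
    (G : ℕ → ℕ → M) :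
    ∑ a ∈ m.divisors, ∑ e ∈ E with e ∣ m / a, G a e =
      ∑ A ∈ m.divisors, ∑ e ∈ E with e ∣ A, G (A / e) e := by
  rw [sum_sigma', sum_sigma']
  refine sum_nbij' (fun t => ⟨t.1 * t.2, t.2⟩) (fun t => ⟨t.1 / t.2, t.2⟩) ?_ ?_ ?_ ?_ ?_
  · rintro ⟨a, e⟩ h
    simp only [mem_sigma, mem_filter, Nat.mem_divisors] at h ⊢
    obtain ⟨⟨ha, -⟩, he, hd⟩ := h
    exact ⟨⟨(Nat.dvd_div_iff_mul_dvd ha).1 hd, hm.ne'⟩, he, dvd_mul_left _ _⟩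
  · rintro ⟨a, e⟩ h
    simp only [mem_sigma, mem_filter, Nat.mem_divisors] at h ⊢
    obtain ⟨⟨ha, -⟩, he, hd⟩ := h
    refine ⟨⟨(Nat.div_dvd_of_dvd hd).trans ha, hm.ne'⟩, he, ?_⟩
    rw [Nat.dvd_div_iff_mul_dvd ((Nat.div_dvd_of_dvd hd).trans ha), Nat.div_mul_cancel hd]
    exact ha
  · rintro ⟨a, e⟩ h
    simp only [mem_sigma, mem_filter, Nat.mem_divisors] at h ⊢
    obtain ⟨⟨ha, -⟩, he, hd⟩ := h
    have : 0 < e := Nat.pos_of_dvd_of_pos (hd.trans (Nat.div_dvd_of_dvd ha)) hm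
    rw [Nat.mul_div_cancel _ this]
  · rintro ⟨a, e⟩ h
    simp only [mem_sigma, mem_filter, Nat.mem_divisors] at h ⊢
    rw [Nat.div_mul_cancel h.2.2]
  · rintro ⟨a, e⟩ h
    simp only [mem_sigma, mem_filter, Nat.mem_divisors] at h ⊢
    obtain ⟨⟨ha, -⟩, he, hd⟩ := h
    have : 0 < e := Nat.pos_of_dvd_of_pos (hd.trans (Nat.div_dvd_of_dvd ha)) hm
    rw [Nat.mul_div_cancel _ this]

theorem numSubrings_eq_sum_unitCount {m n : ℕ} (hm : 0 < m) (hn : 0 < n) :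
    numSubrings m n = ∑ A ∈ m.divisors, ∑ B ∈ n.divisors,
      ∑ e ∈ B.divisors with e ∣ A, unitCount e (A / e) (B / e) := by
  rw [numSubrings_eq_sum_card hm hn, sum_comm, sum_comm (s := m.divisors)]
  refine sum_congr rfl fun b hb => ?_
  have hb0 : 0 < b := Nat.pos_of_mem_divisors hb
  simp only [card_filter_eq_sum_unitCount hb0]
  exact sum_divisors_sum_dvd_div hm b.divisors fun a e => unitCount e a (b / e)

/-- Coprimality to `f` is automatic in the class of `s₀`; coprimality to `d` is detected by `∑ μ(q)`
over `q ∣ d`, `q ∣ s`. If `q` is coprime to `f`, the Chinese remainder theorem leaves one class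
modulo `q f`, hence `d / q` values; otherwise `q ∣ s` is impossible. -/
lemma card_coprime_modEq {d f s₀ : ℕ} (hd : 0 < d) (hf : 0 < f) (hs₀ : s₀.Coprime f) :
    (((range (d * f)).filter fun s => s.Coprime (d * f) ∧ s ≡ s₀ [MOD f]).card : ℤ) =
      ∑ p ∈ d.divisorsAntidiagonal, if p.1.Coprime f then μ p.1 * p.2 else 0 := by
  have h1 : ∀ s : ℕ, s ≡ s₀ [MOD f] → (s.Coprime (d * f) ↔ s.Coprime d) := by
    intro s hs
    rw [Nat.coprime_mul_iff_right]
    refine and_iff_left ?_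
    rw [Nat.coprime_iff_gcd_eq_one, hs.gcd_eq]
    exact hs₀
  have h2 : (((range (d * f)).filter fun s => s.Coprime (d * f) ∧ s ≡ s₀ [MOD f]).card : ℤ) =
      ∑ s ∈ range (d * f) with s ≡ s₀ [MOD f], ∑ q ∈ d.divisors with q ∣ s, μ q := by
    rw [card_filter, sum_filter]
    push_cast
    refine sum_congr rfl fun s _ => ?_
    rw [sum_divisors_dvd_moebius hd.ne']
    by_cases h : s ≡ s₀ [MOD f]
    · simp [h, h1 s h, Nat.coprime_comm]
    · simp [h]
  rw [h2]
  simp only [sum_filter (s := d.divisors)]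
  rw [sum_comm, Nat.sum_divisorsAntidiagonal fun q l => if q.Coprime f then μ q * (l : ℤ) else 0]
  refine sum_congr rfl fun q hq => ?_
  have hqd := Nat.dvd_of_mem_divisors hq
  have hq0 : 0 < q := Nat.pos_of_mem_divisors hq
  obtain ⟨l, rfl⟩ := hqd
  simp only [Nat.mul_div_cancel_left _ hq0]
  rw [← sum_filter, sum_const, filter_filter, nsmul_eq_mul, mul_comm (μ q)]
  by_cases hqf : q.Coprime f
  · rw [if_pos hqf]
    congr 2
    obtain ⟨c, hc1, hc2⟩ := Nat.chineseRemainder hqf 0 s₀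
    have h3 : ∀ s, (s ≡ s₀ [MOD f] ∧ q ∣ s) ↔ s ≡ c [MOD q * f] := by
      intro s
      rw [← Nat.modEq_and_modEq_iff_modEq_mul hqf, ← Nat.modEq_zero_iff_dvd]
      constructor
      · exact fun ⟨h, h'⟩ => ⟨h'.trans hc1.symm, h.trans hc2.symm⟩
      · exact fun ⟨h, h'⟩ => ⟨h'.trans hc2, h.trans hc1⟩
    simp only [h3]
    have := Nat.count_modEq_card (b := q * l * f) (r := q * f) (by positivity) c
    rw [Nat.count_eq_card_filter_range] at this
    rw [this, show q * l * f = q * f * l by ring, Nat.mul_div_cancel_left _ (by positivity),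
      Nat.mul_mod_right]
    simp
  · rw [if_neg hqf]
    rw [filter_false_of_mem]
    · simp
    · rintro s - ⟨h, h'⟩
      apply hqf
      have : s.Coprime f := by rw [Nat.coprime_iff_gcd_eq_one, h.gcd_eq]; exact hs₀
      exact Nat.Coprime.coprime_dvd_left h' this

end Arithmetic

/-! ### Möbius evaluation of the unit counts -/

section ArithmeticIdentity

open ArithmeticFunction Finset
open scoped ArithmeticFunction.Moebius

/-- Multiplying `g` by a unit modulo `e` does not change its gcd with `e`. -/
lemma unitCount_eq_zero {e a g : ℕ} (h : a.gcd e ≠ g.gcd e) : unitCount e a g = 0 := by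
  rw [unitCount, card_eq_zero, filter_false_of_mem]
  rintro s - ⟨hs, hd⟩
  apply h
  have h1 : a ≡ g * s [MOD e] := (Nat.modEq_iff_dvd).2 (by push_cast; exact hd)
  rw [h1.gcd_eq, Nat.Coprime.gcd_mul_right_cancel _ hs]

/-- Dividing by `d` and inverting `g` modulo `f` turns the congruence into `s ≡ g⁻¹ a` modulo `f`, a
single unit class. -/
lemma unitCount_mul {d f a g : ℕ} (hd : 0 < d) (hf : 0 < f) (ha : a.Coprime f)
    (hg : g.Coprime f) :
    (unitCount (d * f) (d * a) (d * g) : ℤ) =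
      ∑ p ∈ d.divisorsAntidiagonal with p.1.Coprime f, μ p.1 * p.2 := by
  obtain ⟨c, hc⟩ : ∃ c, g * c ≡ 1 [MOD f] := by
    obtain ⟨c, hc⟩ := ((ZMod.isUnit_iff_coprime g f).2 hg).exists_right_inv
    have : NeZero f := ⟨hf.ne'⟩
    refine ⟨c.val, (ZMod.natCast_eq_natCast_iff _ _ _).1 ?_⟩
    simpa using hc
  have hs₀ : (c * a).Coprime f := by
    refine Nat.Coprime.mul_left ?_ ha
    refine Nat.Coprime.coprime_mul_left (k := g) ?_
    rw [Nat.coprime_iff_gcd_eq_one, hc.gcd_eq, Nat.gcd_one_left]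
  rw [sum_filter, ← card_coprime_modEq hd hf hs₀, unitCount]
  congr 2
  ext s
  simp only [mem_filter, mem_range, and_congr_right_iff]
  intro _ _
  have h1 : ((d * f : ℕ) : ℤ) ∣ (d * g : ℕ) * s - (d * a : ℕ) ↔ a ≡ g * s [MOD f] := by
    rw [Nat.modEq_iff_dvd]
    push_cast
    rw [mul_assoc, ← mul_sub]
    exact mul_dvd_mul_iff_left (by exact_mod_cast hd.ne')
  rw [h1]
  constructor
  · intro h
    calc s = 1 * s := (one_mul s).symm
      _ ≡ g * c * s [MOD f] := (hc.mul_right s).symm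
      _ = c * (g * s) := by ring
      _ ≡ c * a [MOD f] := (h.mul_left c).symm
  · intro h
    calc a = 1 * a := (one_mul a).symm
      _ ≡ g * c * a [MOD f] := (hc.mul_right a).symm
      _ = g * (c * a) := by ring
      _ ≡ g * s [MOD f] := (h.mul_left g).symm

/-- At most one factorization `e = d f` survives the filter. Writing it as a sum makes `d` and `f`
summation variables for the regrouping. -/
lemma unitCount_eq_sum {e : ℕ} (he : 0 < e) (a g : ℕ) :
    (unitCount e a g : ℤ) =
      ∑ p ∈ e.divisorsAntidiagonal with a.gcd e = p.1 ∧ g.gcd e = p.1,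
        ∑ t ∈ p.1.divisorsAntidiagonal with t.1.Coprime p.2, μ t.1 * t.2 := by
  by_cases h : a.gcd e = g.gcd e
  · have hd : 0 < a.gcd e := Nat.gcd_pos_of_pos_right _ he
    obtain ⟨d, a', f, hd0, hcop, ha, hf⟩ := Nat.exists_coprime' hd
    obtain ⟨d', g', f', hd0', hcop', hg, hf'⟩ := Nat.exists_coprime' (h ▸ hd : 0 < g.gcd e)
    have hda : a.gcd e = d := by rw [ha, hf, Nat.gcd_mul_right, hcop.gcd_eq_one, one_mul]
    have hdg : g.gcd e = d' := by rw [hg, hf', Nat.gcd_mul_right, hcop'.gcd_eq_one, one_mul]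
    obtain rfl : d = d' := by rw [← hda, h, hdg]
    obtain rfl : f = f' := Nat.eq_of_mul_eq_mul_right hd0 (hf.symm.trans hf')
    have hf0 : 0 < f := Nat.pos_of_ne_zero (by rintro rfl; simp [hf] at he)
    have hfil : (e.divisorsAntidiagonal.filter fun p => a.gcd e = p.1 ∧ g.gcd e = p.1) =
        {(d, f)} := by
      ext ⟨p, p'⟩
      simp only [mem_filter, Nat.mem_divisorsAntidiagonal, mem_singleton, Prod.mk.injEq, hda, hdg,
        and_self]
      constructor
      · rintro ⟨⟨h1, -⟩, rfl⟩
        exact ⟨rfl, Nat.eq_of_mul_eq_mul_left hd0 (by rw [h1, hf, mul_comm])⟩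
      · rintro ⟨rfl, rfl⟩
        exact ⟨⟨by rw [hf, mul_comm], he.ne'⟩, rfl⟩
    rw [hfil, sum_singleton, ← unitCount_mul hd0 hf0 hcop hcop', hf, ha, hg]
    simp only [mul_comm]
  · rw [unitCount_eq_zero h, filter_false_of_mem]
    · simp
    · rintro p - ⟨h1, h2⟩
      exact h (h1.trans h2.symm)

/-- The gcd condition forces `A = d² f c`; then `gcd(d c, d f) = d` says that `c` and `f` are
coprime, which the Möbius sum over `x ∣ gcd(f, c)` detects. -/
lemma sum_moebius_eq_ite {A d f : ℕ} (hA : 0 < A) (hd : 0 < d) (hf : 0 < f) :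
    ∑ x ∈ A.divisors with x ∣ f ∧ d ^ 2 * f * x ∣ A, μ x =
      if d * f ∣ A ∧ (A / (d * f)).gcd (d * f) = d then 1 else 0 := by
  by_cases h : d ^ 2 * f ∣ A
  · obtain ⟨c, rfl⟩ := h
    have hc : 0 < c := Nat.pos_of_mul_pos_left hA
    have hdf : 0 < d ^ 2 * f := by positivity
    have h1 : ((d ^ 2 * f * c).divisors.filter fun x => x ∣ f ∧ d ^ 2 * f * x ∣ d ^ 2 * f * c) =
        f.divisors.filter (· ∣ c) := by
      ext x
      simp only [mem_filter, Nat.mem_divisors, Nat.mul_dvd_mul_iff_left hdf]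
      constructor
      · rintro ⟨-, h1, h2⟩; exact ⟨⟨h1, hf.ne'⟩, h2⟩
      · rintro ⟨⟨h1, -⟩, h2⟩; exact ⟨⟨Dvd.dvd.mul_left h2 _, hA.ne'⟩, h1, h2⟩
    rw [h1, sum_divisors_dvd_moebius hf.ne']
    have h2 : d ^ 2 * f * c = d * f * (d * c) := by ring
    rw [h2, Nat.mul_div_cancel_left _ (by positivity), Nat.gcd_mul_left]
    congr 1
    simp only [dvd_mul_right, true_and, eq_iff_iff]
    rw [Nat.mul_eq_left hd.ne', Nat.gcd_comm]
  · rw [filter_false_of_mem, sum_empty, if_neg]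
    · rintro ⟨⟨c, rfl⟩, h2⟩
      rw [Nat.mul_div_cancel_left _ (by positivity)] at h2
      obtain ⟨c', rfl⟩ : d ∣ c := by rw [← h2]; exact Nat.gcd_dvd_left _ _
      exact h ⟨c', by ring⟩
    · rintro x - ⟨-, h2⟩
      exact h ((dvd_mul_right _ _).trans h2)

lemma mul_ite_mul_ite (P Q : Prop) [Decidable P] [Decidable Q] (c : ℤ) :
    c * ((if P then 1 else 0) * if Q then 1 else 0) = if P ∧ Q then c else 0 := by
  by_cases hP : P <;> by_cases hQ : Q <;> simp [hP, hQ]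

/-- `∑_{e ∣ A, e ∣ B} unitCount e (A / e) (B / e)` as a sum of Möbius functions. -/
lemma sum_unitCount_eq_sum_moebius {A B : ℕ} (hA : 0 < A) (hB : 0 < B) :
    ((∑ e ∈ B.divisors with e ∣ A, unitCount e (A / e) (B / e) : ℕ) : ℤ) =
      ∑ t ∈ A.divisors ×ˢ A.divisors ×ˢ A.divisors with t.1.Coprime t.2.2,
        (μ t.1 * t.2.1 *
          ((∑ x ∈ A.divisors with x ∣ t.2.2 ∧ (t.1 * t.2.1) ^ 2 * t.2.2 * x ∣ A, μ x) *
          ∑ y ∈ B.divisors with y ∣ t.2.2 ∧ (t.1 * t.2.1) ^ 2 * t.2.2 * y ∣ B, μ y)) := by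
  push_cast
  have h1 : ∀ e ∈ B.divisors.filter (· ∣ A), (unitCount e (A / e) (B / e) : ℤ) =
      ∑ p ∈ e.divisorsAntidiagonal with (A / e).gcd e = p.1 ∧ (B / e).gcd e = p.1,
        ∑ t ∈ p.1.divisorsAntidiagonal with t.1.Coprime p.2, μ t.1 * t.2 := fun e he =>
    unitCount_eq_sum (Nat.pos_of_mem_divisors (mem_filter.1 he).1) _ _
  rw [sum_congr rfl h1]
  simp only [sum_sigma']
  have h2 : ∀ t ∈ (A.divisors ×ˢ A.divisors ×ˢ A.divisors).filter fun t => t.1.Coprime t.2.2,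
      (μ t.1 * t.2.1 *
          ((∑ x ∈ A.divisors with x ∣ t.2.2 ∧ (t.1 * t.2.1) ^ 2 * t.2.2 * x ∣ A, μ x) *
          ∑ y ∈ B.divisors with y ∣ t.2.2 ∧ (t.1 * t.2.1) ^ 2 * t.2.2 * y ∣ B, μ y)) =
      if (t.1 * t.2.1 * t.2.2 ∣ A ∧ (A / (t.1 * t.2.1 * t.2.2)).gcd (t.1 * t.2.1 * t.2.2) =
          t.1 * t.2.1) ∧ (t.1 * t.2.1 * t.2.2 ∣ B ∧
          (B / (t.1 * t.2.1 * t.2.2)).gcd (t.1 * t.2.1 * t.2.2) = t.1 * t.2.1)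
        then μ t.1 * t.2.1 else 0 := by
    rintro ⟨q, l, f⟩ ht
    simp only [mem_filter, mem_product] at ht ⊢
    have hq := Nat.pos_of_mem_divisors ht.1.1
    have hl := Nat.pos_of_mem_divisors ht.1.2.1
    have hf := Nat.pos_of_mem_divisors ht.1.2.2
    rw [sum_moebius_eq_ite hA (Nat.mul_pos hq hl) hf, sum_moebius_eq_ite hB (Nat.mul_pos hq hl) hf,
      mul_ite_mul_ite]
  rw [sum_congr rfl h2, ← sum_filter]
  -- The triple `(q, l, f)` carries all the data, as `d = q l` and `e = q l f`.
  refine sum_nbij' (fun t => (t.2.2.1, t.2.2.2, t.2.1.2))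
    (fun t => ⟨t.1 * t.2.1 * t.2.2, ⟨(t.1 * t.2.1, t.2.2), (t.1, t.2.1)⟩⟩) ?_ ?_ ?_ ?_ ?_
  · rintro ⟨e, ⟨d, f⟩, q, l⟩ h
    simp only [mem_sigma, mem_filter, mem_product, Nat.mem_divisors,
      Nat.mem_divisorsAntidiagonal] at h ⊢
    obtain ⟨⟨⟨h1, -⟩, h2⟩, ⟨⟨rfl, -⟩, h3, h4⟩, ⟨rfl, h5⟩, h6⟩ := h
    refine ⟨⟨⟨⟨?_, hA.ne'⟩, ⟨?_, hA.ne'⟩, ?_, hA.ne'⟩, h6⟩, ⟨h2, h3⟩, h1, h4⟩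
    · exact Dvd.dvd.trans ⟨l * f, by ring⟩ h2
    · exact Dvd.dvd.trans ⟨q * f, by ring⟩ h2
    · exact Dvd.dvd.trans ⟨q * l, by ring⟩ h2
  · rintro ⟨q, l, f⟩ h
    simp only [mem_sigma, mem_filter, mem_product, Nat.mem_divisors,
      Nat.mem_divisorsAntidiagonal] at h ⊢
    obtain ⟨⟨⟨⟨h1, -⟩, ⟨h2, -⟩, h3, -⟩, h4⟩, ⟨h5, h6⟩, h7, h8⟩ := h
    have h0 : q * l * f ≠ 0 := (Nat.pos_of_dvd_of_pos h5 hA).ne'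
    exact ⟨⟨⟨h7, hB.ne'⟩, h5⟩, ⟨⟨trivial, h0⟩, h6, h8⟩, ⟨trivial, left_ne_zero_of_mul h0⟩, h4⟩
  · rintro ⟨e, ⟨d, f⟩, q, l⟩ h
    simp only [mem_sigma, mem_filter, Nat.mem_divisorsAntidiagonal] at h ⊢
    obtain ⟨-, ⟨⟨rfl, -⟩, -⟩, ⟨rfl, -⟩, -⟩ := h
    rfl
  · rintro ⟨q, l, f⟩ -
    rfl
  · rintro ⟨e, ⟨d, f⟩, q, l⟩ -
    rfl

/-- If `r x` and `r y` are squarefree, then `μ(h x) μ(h y) = μ(x) μ(y)` for every `h ∣ r` because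
`μ(h)² = 1`. What remains is the sum of `μ(q)` over `q ∣ r` coprime to `f`, that is over the
divisors of `r / gcd(r, f)`. Otherwise both sides vanish: a nonzero term would make `q h x` and `q h
y` squarefree. -/
lemma sum_antidiagonal_moebius {r f x y : ℕ} (hr : 0 < r) :
    ∑ p ∈ r.divisorsAntidiagonal with p.1.Coprime (p.2 * x * y * f),
      μ p.1 * μ (p.2 * x) * μ (p.2 * y) = if r ∣ f then μ (r * x) * μ (r * y) else 0 := by
  by_cases h : Squarefree (r * x) ∧ Squarefree (r * y)
  · obtain ⟨hx, hy⟩ := h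
    have hr2 : Squarefree r := hx.of_mul_left
    have hcx : r.Coprime x := Nat.coprime_of_squarefree_mul hx
    have hcy : r.Coprime y := Nat.coprime_of_squarefree_mul hy
    have hμ : ∀ h, h ∣ r → μ (h * x) * μ (h * y) = μ x * μ y := by
      intro h hh
      rw [isMultiplicative_moebius.map_mul_of_coprime (hcx.coprime_dvd_left hh),
        isMultiplicative_moebius.map_mul_of_coprime (hcy.coprime_dvd_left hh)]
      have := moebius_sq_eq_one_of_squarefree (hr2.squarefree_of_dvd hh)
      linear_combination (μ x * μ y) * this
    rw [hμ r dvd_rfl, sum_filter]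
    have h1 : ∀ p ∈ r.divisorsAntidiagonal, (if p.1.Coprime (p.2 * x * y * f) then
        μ p.1 * μ (p.2 * x) * μ (p.2 * y) else 0) =
        (fun q _ => if q.Coprime f then μ q * (μ x * μ y) else 0) p.1 p.2 := by
      rintro ⟨q, h⟩ hp
      rw [Nat.mem_divisorsAntidiagonal] at hp
      obtain ⟨rfl, -⟩ := hp
      simp only
      have hqh : q.Coprime h := Nat.coprime_of_squarefree_mul hr2
      have hqx : q.Coprime x := hcx.coprime_dvd_left (dvd_mul_right _ _)
      have hqy : q.Coprime y := hcy.coprime_dvd_left (dvd_mul_right _ _)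
      rw [mul_assoc (μ q), hμ h (dvd_mul_left _ _)]
      refine if_congr ?_ rfl rfl
      rw [Nat.coprime_mul_iff_right, Nat.coprime_mul_iff_right, Nat.coprime_mul_iff_right]
      exact and_iff_right ⟨⟨hqh, hqx⟩, hqy⟩
    rw [sum_congr rfl h1, Nat.sum_divisorsAntidiagonal
      (fun q _ => if q.Coprime f then μ q * (μ x * μ y) else 0), ← sum_filter, ← sum_mul]
    obtain ⟨g, r', f', hg, hcop, hr', hf'⟩ := Nat.exists_coprime' (Nat.gcd_pos_of_pos_left f hr)
    have hgr : g.Coprime r' := by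
      rw [hr', mul_comm] at hr2
      exact Nat.coprime_of_squarefree_mul hr2
    have hr0 : 0 < r' := Nat.pos_of_ne_zero (by rintro rfl; simp [hr'] at hr)
    have h2 : (r.divisors.filter fun q => q.Coprime f) = r'.divisors := by
      ext q
      simp only [mem_filter, Nat.mem_divisors, hr', hf']
      constructor
      · rintro ⟨⟨h1, -⟩, h2⟩
        exact ⟨(Nat.Coprime.coprime_mul_left_right h2).dvd_of_dvd_mul_right h1, hr0.ne'⟩
      · rintro ⟨h1, -⟩
        exact ⟨⟨Dvd.dvd.mul_right h1 _, by positivity⟩,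
          (hcop.mul_right hgr.symm).coprime_dvd_left h1⟩
    rw [h2, sum_divisors_moebius]
    have h3 : r' = 1 ↔ r ∣ f := by
      rw [hr', hf', Nat.mul_dvd_mul_iff_right hg]
      constructor
      · rintro rfl; exact one_dvd _
      · exact fun h => hcop.eq_one_of_dvd h
    simp [h3]
  · have h1 : μ (r * x) * μ (r * y) = 0 := by
      rw [not_and_or] at h
      rcases h with h | h <;> simp [moebius_eq_zero_of_not_squarefree h]
    rw [h1, ite_self]
    refine sum_eq_zero ?_
    rintro ⟨q, k⟩ hp
    simp only [mem_filter, Nat.mem_divisorsAntidiagonal] at hp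
    obtain ⟨⟨rfl, -⟩, hc⟩ := hp
    by_contra hne
    have hq := moebius_ne_zero_iff_squarefree.1 (left_ne_zero_of_mul (left_ne_zero_of_mul hne))
    have hx := moebius_ne_zero_iff_squarefree.1 (right_ne_zero_of_mul (left_ne_zero_of_mul hne))
    have hy := moebius_ne_zero_iff_squarefree.1 (right_ne_zero_of_mul hne)
    have hcx : q.Coprime (k * x) := hc.coprime_dvd_right ⟨y * f, by ring⟩
    have hcy : q.Coprime (k * y) := hc.coprime_dvd_right ⟨x * f, by ring⟩
    apply h
    rw [mul_assoc, mul_assoc]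
    exact ⟨(Nat.squarefree_mul hcx).2 ⟨hq, hx⟩, (Nat.squarefree_mul hcy).2 ⟨hq, hy⟩⟩

end ArithmeticIdentity

/-! ### Regrouping into quadruples `(k, l, u, v)` -/

section Regrouping

open ArithmeticFunction Finset
open scoped ArithmeticFunction.Moebius

lemma sum_moebius_eq_sum_quintuple (A B : ℕ) :
    ∑ t ∈ A.divisors ×ˢ A.divisors ×ˢ A.divisors with t.1.Coprime t.2.2,
        (μ t.1 * t.2.1 *
          ((∑ x ∈ A.divisors with x ∣ t.2.2 ∧ (t.1 * t.2.1) ^ 2 * t.2.2 * x ∣ A, μ x) *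
          ∑ y ∈ B.divisors with y ∣ t.2.2 ∧ (t.1 * t.2.1) ^ 2 * t.2.2 * y ∣ B, μ y)) =
      ∑ t ∈ A.divisors ×ˢ A.divisors ×ˢ A.divisors ×ˢ A.divisors ×ˢ B.divisors with
        t.1.Coprime t.2.2.1 ∧ t.2.2.2.1 ∣ t.2.2.1 ∧ t.2.2.2.2 ∣ t.2.2.1 ∧
        (t.1 * t.2.1) ^ 2 * t.2.2.1 * t.2.2.2.1 ∣ A ∧ (t.1 * t.2.1) ^ 2 * t.2.2.1 * t.2.2.2.2 ∣ B,
        t.2.1 * (μ t.1 * μ t.2.2.2.1 * μ t.2.2.2.2) := by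
  simp only [sum_mul_sum]
  simp only [mul_sum]
  simp only [sum_sigma']
  refine sum_nbij' (fun t => (t.1.1, t.1.2.1, t.1.2.2, t.2.1, t.2.2))
    (fun t => ⟨(t.1, t.2.1, t.2.2.1), t.2.2.2.1, t.2.2.2.2⟩) ?_ ?_ ?_ ?_ ?_
  · rintro ⟨⟨q, l, f⟩, x, y⟩ h
    simp only [mem_sigma, mem_filter, mem_product] at h ⊢
    tauto
  · rintro ⟨q, l, f, x, y⟩ h
    simp only [mem_sigma, mem_filter, mem_product] at h ⊢
    tauto
  · rintro ⟨⟨q, l, f⟩, x, y⟩ -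
    rfl
  · rintro ⟨q, l, f, x, y⟩ -
    rfl
  · rintro ⟨⟨q, l, f⟩, x, y⟩ -
    simp only
    ring

lemma eq_of_mul_coprime {h x y h' x' y' : ℕ} (hh : 0 < h) (hc : x.Coprime y) (hc' : x'.Coprime y')
    (hx : h * x = h' * x') (hy : h * y = h' * y') : h = h' ∧ x = x' ∧ y = y' := by
  obtain rfl : h = h' := by
    have := Nat.gcd_mul_left h x y
    rw [hc.gcd_eq_one, hx, hy, Nat.gcd_mul_left, hc'.gcd_eq_one] at this
    omega
  exact ⟨rfl, Nat.eq_of_mul_eq_mul_left hh hx, Nat.eq_of_mul_eq_mul_left hh hy⟩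

/-- Extract `h = gcd(x, y)`: as `lcm(x, y) ∣ f`, write `x = h x'`, `y = h y'`, `f = h x' y' f'`.
Then `q` and `h` enter the divisibility conditions only through `r = q h`, leaving an inner sum over
its factorizations. -/
lemma sum_quintuple_eq_sum_sigma {A B : ℕ} (hA : 0 < A) (hB : 0 < B) :
    ∑ t ∈ A.divisors ×ˢ A.divisors ×ˢ A.divisors ×ˢ A.divisors ×ˢ B.divisors with
        t.1.Coprime t.2.2.1 ∧ t.2.2.2.1 ∣ t.2.2.1 ∧ t.2.2.2.2 ∣ t.2.2.1 ∧
        (t.1 * t.2.1) ^ 2 * t.2.2.1 * t.2.2.2.1 ∣ A ∧ (t.1 * t.2.1) ^ 2 * t.2.2.1 * t.2.2.2.2 ∣ B,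
        t.2.1 * (μ t.1 * μ t.2.2.2.1 * μ t.2.2.2.2) =
      ∑ t ∈ A.divisors ×ˢ A.divisors ×ˢ A.divisors ×ˢ A.divisors ×ˢ A.divisors with
        t.2.2.2.1.Coprime t.2.2.2.2 ∧
        t.1 ^ 2 * t.2.1 ^ 2 * t.2.2.1 * t.2.2.2.1 ^ 2 * t.2.2.2.2 ∣ A ∧
        t.1 ^ 2 * t.2.1 ^ 2 * t.2.2.1 * t.2.2.2.1 * t.2.2.2.2 ^ 2 ∣ B,
        ∑ p ∈ t.1.divisorsAntidiagonal with
          p.1.Coprime (p.2 * t.2.2.2.1 * t.2.2.2.2 * t.2.2.1),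
          t.2.1 * (μ p.1 * μ (p.2 * t.2.2.2.1) * μ (p.2 * t.2.2.2.2)) := by
  simp only [sum_sigma']
  symm
  refine sum_bij (fun t _ => (t.2.1, t.1.2.1, t.2.2 * t.1.2.2.2.1 * t.1.2.2.2.2 * t.1.2.2.1,
    t.2.2 * t.1.2.2.2.1, t.2.2 * t.1.2.2.2.2)) ?_ ?_ ?_ ?_
  · rintro ⟨⟨r, l, f, x, y⟩, q, h⟩ ht
    simp only [mem_sigma, mem_filter, mem_product, Nat.mem_divisors,
      Nat.mem_divisorsAntidiagonal] at ht ⊢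
    obtain ⟨⟨-, h1, h2, h3⟩, ⟨rfl, -⟩, h5⟩ := ht
    have e2 : (q * l) ^ 2 * (h * x * y * f) * (h * x) = (q * h) ^ 2 * l ^ 2 * f * x ^ 2 * y := by
      ring
    have e3 : (q * l) ^ 2 * (h * x * y * f) * (h * y) = (q * h) ^ 2 * l ^ 2 * f * x * y ^ 2 := by
      ring
    rw [← e2] at h2
    rw [← e3] at h3
    refine ⟨⟨⟨?_, hA.ne'⟩, ⟨?_, hA.ne'⟩, ⟨?_, hA.ne'⟩, ⟨?_, hA.ne'⟩, ?_, hB.ne'⟩, h5,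
      ⟨y * f, by ring⟩, ⟨x * f, by ring⟩, h2, h3⟩
    · exact Dvd.dvd.trans ⟨q * l ^ 2 * (h * x * y * f) * (h * x), by ring⟩ h2
    · exact Dvd.dvd.trans ⟨q ^ 2 * l * (h * x * y * f) * (h * x), by ring⟩ h2
    · exact Dvd.dvd.trans ⟨(q * l) ^ 2 * (h * x), by ring⟩ h2
    · exact (dvd_mul_left _ _).trans h2
    · exact (dvd_mul_left _ _).trans h3
  · rintro ⟨⟨r, l, f, x, y⟩, q, h⟩ ht ⟨⟨r', l', f', x', y'⟩, q', h'⟩ ht' heq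
    simp only [mem_sigma, mem_filter, mem_product, Nat.mem_divisors,
      Nat.mem_divisorsAntidiagonal] at ht ht'
    obtain ⟨⟨h0, h1, h2, h3⟩, ⟨rfl, h4⟩, h5⟩ := ht
    obtain ⟨⟨-, h1', h2', h3'⟩, ⟨rfl, -⟩, h5'⟩ := ht'
    simp only [Prod.mk.injEq] at heq
    obtain ⟨rfl, rfl, hf, hx, hy⟩ := heq
    have hh : 0 < h := Nat.pos_of_ne_zero (right_ne_zero_of_mul h4)
    obtain ⟨rfl, rfl, rfl⟩ := eq_of_mul_coprime hh h1 h1' hx hy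
    have hx0 : 0 < x := Nat.pos_of_dvd_of_pos h0.2.2.2.1.1 hA
    have hy0 : 0 < y := Nat.pos_of_dvd_of_pos h0.2.2.2.2.1 hA
    obtain rfl : f = f' := Nat.eq_of_mul_eq_mul_left (by positivity) hf
    rfl
  · rintro ⟨q, l, f, x, y⟩ ht
    simp only [mem_filter, mem_product, Nat.mem_divisors] at ht
    obtain ⟨⟨⟨hq, -⟩, ⟨hl, -⟩, ⟨hf, -⟩, ⟨hx, -⟩, hy, -⟩, h1, h2, h3, h4, h5⟩ := ht
    have hx0 : 0 < x := Nat.pos_of_dvd_of_pos hx hA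
    obtain ⟨h, x', y', hh, hcop, hx', hy'⟩ := Nat.exists_coprime' (Nat.gcd_pos_of_pos_left y hx0)
    obtain ⟨f', rfl⟩ : h * x' * y' ∣ f := by
      have h6 := Nat.lcm_dvd h2 h3
      rwa [hx', hy', Nat.lcm_mul_right, hcop.lcm_eq_mul, mul_comm, ← mul_assoc] at h6
    rw [hx'] at h4
    rw [hy'] at h5
    have e2 : (q * l) ^ 2 * (h * x' * y' * f') * (x' * h) =
      (q * h) ^ 2 * l ^ 2 * f' * x' ^ 2 * y' := by ring
    have e3 : (q * l) ^ 2 * (h * x' * y' * f') * (y' * h) =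
      (q * h) ^ 2 * l ^ 2 * f' * x' * y' ^ 2 := by ring
    rw [e2] at h4
    rw [e3] at h5
    refine ⟨⟨(q * h, l, f', x', y'), q, h⟩, ?_, ?_⟩
    · simp only [mem_sigma, mem_filter, mem_product, Nat.mem_divisors,
        Nat.mem_divisorsAntidiagonal]
      have hq0 := Nat.pos_of_dvd_of_pos hq hA
      refine ⟨⟨⟨⟨?_, hA.ne'⟩, ⟨hl, hA.ne'⟩, ⟨?_, hA.ne'⟩, ⟨?_, hA.ne'⟩, ?_, hA.ne'⟩, hcop, h4, h5⟩,
        ⟨trivial, by positivity⟩, h1⟩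
      · exact Dvd.dvd.trans ⟨(q * h) * l ^ 2 * f' * x' ^ 2 * y', by ring⟩ h4
      · exact Dvd.dvd.trans ⟨(q * h) ^ 2 * l ^ 2 * x' ^ 2 * y', by ring⟩ h4
      · exact Dvd.dvd.trans ⟨(q * h) ^ 2 * l ^ 2 * f' * x' * y', by ring⟩ h4
      · exact (dvd_mul_left _ _).trans h4
    · simp only [hx', hy', mul_comm h]
  · rintro ⟨⟨r, l, f, x, y⟩, q, h⟩ -
    rfl

/-- The inner sum forces `r ∣ f`. Put `k = f / r`, `u = r y`, `v = r x`; since `x` and `y` are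
coprime, `r = gcd(u, v)` is recovered, so `u` and `v` become independent. -/
lemma sum_sigma_eq_sum_quadruple {A B : ℕ} (hA : 0 < A) :
    ∑ t ∈ A.divisors ×ˢ A.divisors ×ˢ A.divisors ×ˢ A.divisors ×ˢ A.divisors with
        t.2.2.2.1.Coprime t.2.2.2.2 ∧
        t.1 ^ 2 * t.2.1 ^ 2 * t.2.2.1 * t.2.2.2.1 ^ 2 * t.2.2.2.2 ∣ A ∧
        t.1 ^ 2 * t.2.1 ^ 2 * t.2.2.1 * t.2.2.2.1 * t.2.2.2.2 ^ 2 ∣ B,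
        ∑ p ∈ t.1.divisorsAntidiagonal with
          p.1.Coprime (p.2 * t.2.2.2.1 * t.2.2.2.2 * t.2.2.1),
          t.2.1 * (μ p.1 * μ (p.2 * t.2.2.2.1) * μ (p.2 * t.2.2.2.2)) =
      ∑ t ∈ A.divisors ×ˢ A.divisors ×ˢ A.divisors ×ˢ A.divisors with
        t.1 * t.2.1 ^ 2 * t.2.2.1 * t.2.2.2 ^ 2 ∣ A ∧
        t.1 * t.2.1 ^ 2 * t.2.2.1 ^ 2 * t.2.2.2 ∣ B,
        t.2.1 * (μ t.2.2.1 * μ t.2.2.2) := by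
  have h1 : ∀ t ∈ (A.divisors ×ˢ A.divisors ×ˢ A.divisors ×ˢ A.divisors ×ˢ A.divisors).filter
      (fun t => t.2.2.2.1.Coprime t.2.2.2.2 ∧
        t.1 ^ 2 * t.2.1 ^ 2 * t.2.2.1 * t.2.2.2.1 ^ 2 * t.2.2.2.2 ∣ A ∧
        t.1 ^ 2 * t.2.1 ^ 2 * t.2.2.1 * t.2.2.2.1 * t.2.2.2.2 ^ 2 ∣ B),
      ∑ p ∈ t.1.divisorsAntidiagonal with
          p.1.Coprime (p.2 * t.2.2.2.1 * t.2.2.2.2 * t.2.2.1),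
          t.2.1 * (μ p.1 * μ (p.2 * t.2.2.2.1) * μ (p.2 * t.2.2.2.2)) =
        if t.1 ∣ t.2.2.1 then t.2.1 * (μ (t.1 * t.2.2.2.1) * μ (t.1 * t.2.2.2.2)) else 0 := by
    rintro ⟨r, l, f, x, y⟩ ht
    simp only [mem_filter, mem_product] at ht
    rw [← mul_sum, sum_antidiagonal_moebius (Nat.pos_of_mem_divisors ht.1.1), mul_ite, mul_zero]
  rw [sum_congr rfl h1, ← sum_filter]
  refine sum_bij (fun t _ => (t.2.2.1 / t.1, t.2.1, t.1 * t.2.2.2.2, t.1 * t.2.2.2.1)) ?_ ?_ ?_ ?_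
  · rintro ⟨r, l, f, x, y⟩ ht
    simp only [mem_filter, mem_product, Nat.mem_divisors] at ht ⊢
    obtain ⟨⟨⟨⟨hr, -⟩, ⟨hl, -⟩, ⟨hf, -⟩, -⟩, h1, h2, h3⟩, k, rfl⟩ := ht
    rw [Nat.mul_div_cancel_left _ (Nat.pos_of_dvd_of_pos hr hA)]
    have e2 : r ^ 2 * l ^ 2 * (r * k) * x ^ 2 * y = k * l ^ 2 * (r * y) * (r * x) ^ 2 := by ring
    have e3 : r ^ 2 * l ^ 2 * (r * k) * x * y ^ 2 = k * l ^ 2 * (r * y) ^ 2 * (r * x) := by ring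
    rw [e2] at h2
    rw [e3] at h3
    refine ⟨⟨⟨?_, hA.ne'⟩, ⟨hl, hA.ne'⟩, ⟨?_, hA.ne'⟩, ?_, hA.ne'⟩, h2, h3⟩
    · exact (dvd_mul_left _ _).trans hf
    · exact Dvd.dvd.trans ⟨k * l ^ 2 * (r * x) ^ 2, by ring⟩ h2
    · exact Dvd.dvd.trans ⟨k * l ^ 2 * (r * y) * (r * x), by ring⟩ h2
  · rintro ⟨r, l, f, x, y⟩ ht ⟨r', l', f', x', y'⟩ ht' heq
    simp only [mem_filter, mem_product, Nat.mem_divisors] at ht ht'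
    obtain ⟨⟨⟨⟨hr, -⟩, -⟩, h1, -⟩, k, rfl⟩ := ht
    obtain ⟨⟨⟨⟨hr', -⟩, -⟩, h1', -⟩, k', rfl⟩ := ht'
    simp only [Prod.mk.injEq] at heq
    rw [Nat.mul_div_cancel_left _ (Nat.pos_of_dvd_of_pos hr hA),
      Nat.mul_div_cancel_left _ (Nat.pos_of_dvd_of_pos hr' hA)] at heq
    obtain ⟨rfl, rfl, hy, hx⟩ := heq
    obtain ⟨rfl, rfl, rfl⟩ := eq_of_mul_coprime (Nat.pos_of_dvd_of_pos hr hA) h1 h1' hx hy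
    rfl
  · rintro ⟨k, l, u, v⟩ ht
    simp only [mem_filter, mem_product, Nat.mem_divisors] at ht
    obtain ⟨⟨⟨hk, -⟩, ⟨hl, -⟩, ⟨hu, -⟩, hv, -⟩, h2, h3⟩ := ht
    obtain ⟨r, x, y, hr, hcop, hx, hy⟩ :=
      Nat.exists_coprime' (Nat.gcd_pos_of_pos_left u (Nat.pos_of_dvd_of_pos hv hA))
    obtain rfl := hx
    obtain rfl := hy
    have e2 : k * l ^ 2 * (y * r) * (x * r) ^ 2 = r ^ 2 * l ^ 2 * (r * k) * x ^ 2 * y := by ring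
    have e3 : k * l ^ 2 * (y * r) ^ 2 * (x * r) = r ^ 2 * l ^ 2 * (r * k) * x * y ^ 2 := by ring
    rw [e2] at h2
    rw [e3] at h3
    refine ⟨(r, l, r * k, x, y), ?_, ?_⟩
    · simp only [mem_filter, mem_product, Nat.mem_divisors]
      refine ⟨⟨⟨⟨(dvd_mul_left _ _).trans hu, hA.ne'⟩, ⟨hl, hA.ne'⟩, ⟨?_, hA.ne'⟩,
        ⟨(dvd_mul_right _ _).trans hv, hA.ne'⟩, (dvd_mul_right _ _).trans hu, hA.ne'⟩,
        hcop, h2, h3⟩, dvd_mul_right _ _⟩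
      exact Dvd.dvd.trans ⟨r ^ 2 * l ^ 2 * x ^ 2 * y, by ring⟩ h2
    · simp only [mul_comm r, Nat.mul_div_cancel _ hr]
  · rintro ⟨r, l, f, x, y⟩ -
    simp only
    ring

/-- The first index `k l² u v²` of the quadruple `(k, l, u, v)`. -/
def indexOne (t : ℕ × ℕ × ℕ × ℕ) : ℕ := t.1 * t.2.1 ^ 2 * t.2.2.1 * t.2.2.2 ^ 2

/-- The second index `k l² u² v` of the quadruple `(k, l, u, v)`. -/
def indexTwo (t : ℕ × ℕ × ℕ × ℕ) : ℕ := t.1 * t.2.1 ^ 2 * t.2.2.1 ^ 2 * t.2.2.2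

/-- The weight `l μ(u) μ(v)` of the quadruple `(k, l, u, v)`. -/
def weight (t : ℕ × ℕ × ℕ × ℕ) : ℤ := t.2.1 * (μ t.2.2.1 * μ t.2.2.2)

lemma sum_unitCount_eq_sum_weight {A B : ℕ} (hA : 0 < A) (hB : 0 < B) :
    ((∑ e ∈ B.divisors with e ∣ A, unitCount e (A / e) (B / e) : ℕ) : ℤ) =
      ∑ t ∈ A.divisors ×ˢ A.divisors ×ˢ A.divisors ×ˢ A.divisors with
        indexOne t ∣ A ∧ indexTwo t ∣ B, weight t := by
  rw [sum_unitCount_eq_sum_moebius hA hB, sum_moebius_eq_sum_quintuple,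
    sum_quintuple_eq_sum_sigma hA hB, sum_sigma_eq_sum_quadruple hA]
  rfl

lemma card_divisors_filter_dvd {m r : ℕ} (hm : 0 < m) (h : r ∣ m) :
    (m.divisors.filter (r ∣ ·)).card = (m / r).divisors.card := by
  obtain ⟨c, rfl⟩ := h
  have hr : 0 < r := Nat.pos_of_mul_pos_right hm
  have hc : 0 < c := Nat.pos_of_mul_pos_left hm
  rw [Nat.mul_div_cancel_left _ hr]
  symm
  refine card_bij (fun d _ => r * d) ?_ ?_ ?_
  · intro d hd
    simp only [mem_filter, Nat.mem_divisors] at hd ⊢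
    exact ⟨⟨Nat.mul_dvd_mul_left r hd.1, hm.ne'⟩, dvd_mul_right _ _⟩
  · exact fun d _ d' _ h => Nat.eq_of_mul_eq_mul_left hr h
  · intro d hd
    simp only [mem_filter, Nat.mem_divisors] at hd
    obtain ⟨⟨h1, -⟩, d', rfl⟩ := hd
    exact ⟨d', Nat.mem_divisors.2 ⟨(Nat.mul_dvd_mul_iff_left hr).1 h1, hc.ne'⟩, rfl⟩

/-- Over a box of quadruples independent of `A` and `B` the sums can be exchanged; the `A` with `r ∣
A ∣ m` then number `τ(m / r)`. -/
theorem numSubrings_eq_sum_weight {m n : ℕ} (hm : 0 < m) (hn : 0 < n) :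
    (numSubrings m n : ℤ) =
      ∑ t ∈ m.divisors ×ˢ m.divisors ×ˢ m.divisors ×ˢ m.divisors,
        if indexOne t ∣ m ∧ indexTwo t ∣ n then
          weight t * ((m / indexOne t).divisors.card * (n / indexTwo t).divisors.card) else 0 := by
  have hbox : ∀ A ∈ m.divisors, ∀ B ∈ n.divisors,
      ((∑ e ∈ B.divisors with e ∣ A, unitCount e (A / e) (B / e) : ℕ) : ℤ) =
      ∑ t ∈ m.divisors ×ˢ m.divisors ×ˢ m.divisors ×ˢ m.divisors,
        (if indexOne t ∣ A then 1 else 0) * (if indexTwo t ∣ B then 1 else 0) * weight t := by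
    intro A hA B hB
    have hA0 := Nat.pos_of_mem_divisors hA
    have hAm := Nat.dvd_of_mem_divisors hA
    rw [sum_unitCount_eq_sum_weight hA0 (Nat.pos_of_mem_divisors hB), sum_filter]
    have hsub := Nat.divisors_subset_of_dvd hm.ne' hAm
    -- Enlarging the box adds only zeros, since `indexOne t ∣ A` makes every component divide `A`.
    rw [sum_subset (product_subset_product hsub (product_subset_product hsub
      (product_subset_product hsub hsub)))]
    · refine sum_congr rfl fun t _ => ?_
      by_cases h1 : indexOne t ∣ A <;> by_cases h2 : indexTwo t ∣ B <;> simp [h1, h2]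
    · rintro ⟨k, l, u, v⟩ - ht
      rw [if_neg]
      rintro ⟨h, -⟩
      apply ht
      simp only [mem_product, Nat.mem_divisors]
      simp only [indexOne] at h
      refine ⟨⟨?_, hA0.ne'⟩, ⟨?_, hA0.ne'⟩, ⟨?_, hA0.ne'⟩, ?_, hA0.ne'⟩
      · exact Dvd.dvd.trans ⟨l ^ 2 * u * v ^ 2, by ring⟩ h
      · exact Dvd.dvd.trans ⟨k * l * u * v ^ 2, by ring⟩ h
      · exact Dvd.dvd.trans ⟨k * l ^ 2 * v ^ 2, by ring⟩ h
      · exact Dvd.dvd.trans ⟨k * l ^ 2 * u * v, by ring⟩ h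
  rw [numSubrings_eq_sum_unitCount hm hn, Nat.cast_sum]
  simp only [Nat.cast_sum (s := n.divisors)]
  rw [sum_congr rfl fun A hA => sum_congr rfl fun B hB => hbox A hA B hB]
  simp only [sum_comm (s := n.divisors)]
  rw [sum_comm]
  refine sum_congr rfl fun t _ => ?_
  simp only [← sum_mul, ← mul_sum]
  simp only [sum_boole]
  split_ifs with h
  · rw [card_divisors_filter_dvd hm h.1, card_divisors_filter_dvd hn h.2, mul_comm]
  · rw [not_and_or] at h
    rcases h with h | h
    · rw [filter_false_of_mem (s := m.divisors)]
      · simp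
      · exact fun A hA hd => h (hd.trans (Nat.dvd_of_mem_divisors hA))
    · rw [filter_false_of_mem (s := n.divisors)]
      · simp
      · exact fun A hA hd => h (hd.trans (Nat.dvd_of_mem_divisors hA))

end Regrouping

/-! ### The double Dirichlet series -/

section DoubleSeries

open ArithmeticFunction LSeries
open scoped ArithmeticFunction.Moebius

/-- The finite identity over one index set for all `m, n`, in a form that can be summed over `m` and
`n`; it serves both `ℂ` and `ℝ`. -/
theorem hasSum_weight_numSubrings (R : Type*) [CommRing R] [TopologicalSpace R] {m n : ℕ}
    (hm : 0 < m) (hn : 0 < n) :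
    HasSum (fun t => if indexOne t ∣ m ∧ indexTwo t ∣ n then
      (weight t : R) * ((m / indexOne t).divisors.card * (n / indexTwo t).divisors.card) else 0)
      (numSubrings m n : R) := by
  have h := congrArg (Int.cast : ℤ → R) (numSubrings_eq_sum_weight hm hn)
  push_cast at h
  rw [h]
  refine hasSum_sum_of_ne_finset_zero ?_
  rintro ⟨k, l, u, v⟩ ht
  rw [if_neg]
  rintro ⟨h, -⟩
  apply ht
  simp only [Finset.mem_product, Nat.mem_divisors]
  simp only [indexOne] at h
  refine ⟨⟨?_, hm.ne'⟩, ⟨?_, hm.ne'⟩, ⟨?_, hm.ne'⟩, ?_, hm.ne'⟩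
  · exact Dvd.dvd.trans ⟨l ^ 2 * u * v ^ 2, by ring⟩ h
  · exact Dvd.dvd.trans ⟨k * l * u * v ^ 2, by ring⟩ h
  · exact Dvd.dvd.trans ⟨k * l ^ 2 * v ^ 2, by ring⟩ h
  · exact Dvd.dvd.trans ⟨k * l ^ 2 * u * v, by ring⟩ h

lemma HasSum.mul_complex {ι κ : Type*} {f : ι → ℂ} {g : κ → ℂ} {a b : ℂ} (hf : HasSum f a)
    (hg : HasSum g b) : HasSum (fun p : ι × κ => f p.1 * g p.2) (a * b) :=
  hf.mul hg (summable_mul_of_summable_norm hf.summable.norm hg.summable.norm)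

lemma hasSum_moebius {s : ℂ} (hs : 1 < s.re) :
    HasSum (LSeries.term (fun n => (μ n : ℂ)) s) (riemannZeta s)⁻¹ := by
  have h1 : LSeriesSummable (fun n => (μ n : ℂ)) s := LSeriesSummable_moebius_iff.2 hs
  have h2 := LSeries_one_mul_Lseries_moebius hs
  rw [LSeries_one_eq_riemannZeta hs] at h2
  rw [← eq_inv_of_mul_eq_one_right h2]
  exact h1.LSeriesHasSum

lemma hasSum_card_divisors {s : ℂ} (hs : 1 < s.re) :
    HasSum (fun n : ℕ => (n.divisors.card : ℂ) / (n : ℂ) ^ s) (riemannZeta s ^ 2) := by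
  have h := (LSeriesHasSum_one hs).convolution (LSeriesHasSum_one hs)
  rw [← sq] at h
  rw [LSeriesHasSum] at h
  convert h using 2 with n
  rcases eq_or_ne n 0 with rfl | hn
  · simp
  · rw [LSeries.term_of_ne_zero hn, LSeries.convolution_def]
    simp [← Nat.map_div_right_divisors]

lemma weight_div_eq_mul {z w : ℂ} (hz : z ≠ 0) (t : ℕ × ℕ × ℕ × ℕ) :
    (weight t : ℂ) / ((indexOne t : ℂ) ^ z * (indexTwo t : ℂ) ^ w) =
      LSeries.term 1 (z + w) t.1 * (LSeries.term 1 (2 * z + 2 * w - 1) t.2.1 *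
        (LSeries.term (fun n => (μ n : ℂ)) (z + 2 * w) t.2.2.1 *
          LSeries.term (fun n => (μ n : ℂ)) (2 * z + w) t.2.2.2)) := by
  obtain ⟨k, l, u, v⟩ := t
  simp only [weight, indexOne, indexTwo]
  rcases eq_or_ne k 0 with rfl | hk
  -- Here the weight may be nonzero, but the indices are `0`: `0 ^ z = 0` and division by zero gives
  -- `0`.
  · simp [hz]
  rcases eq_or_ne l 0 with rfl | hl
  · simp
  rcases eq_or_ne u 0 with rfl | hu
  · simp
  rcases eq_or_ne v 0 with rfl | hv
  · simp
  rw [LSeries.term_of_ne_zero hk, LSeries.term_of_ne_zero hl, LSeries.term_of_ne_zero hu,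
    LSeries.term_of_ne_zero hv]
  have hk' : (k : ℂ) ≠ 0 := by exact_mod_cast hk
  have hl' : (l : ℂ) ≠ 0 := by exact_mod_cast hl
  have hu' : (u : ℂ) ≠ 0 := by exact_mod_cast hu
  have hv' : (v : ℂ) ≠ 0 := by exact_mod_cast hv
  have h2 : ∀ (n : ℕ) (s : ℂ), ((n ^ 2 : ℕ) : ℂ) ^ s = (n : ℂ) ^ s * (n : ℂ) ^ s := by
    intro n s
    rw [sq, Nat.cast_mul, Complex.natCast_mul_natCast_cpow]
  have h3 : ∀ (n : ℕ) (s : ℂ), (n : ℂ) ≠ 0 → (n : ℂ) ^ (2 * s) = (n : ℂ) ^ s * (n : ℂ) ^ s := by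
    intro n s hn
    rw [two_mul, Complex.cpow_add _ _ hn]
  have h1 : ∀ (a b : ℕ) (s : ℂ), ((a * b : ℕ) : ℂ) ^ s = (a : ℂ) ^ s * (b : ℂ) ^ s := by
    intro a b s
    rw [Nat.cast_mul, Complex.natCast_mul_natCast_cpow]
  simp only [h1, h2]
  rw [Complex.cpow_sub _ _ hl', Complex.cpow_one, Complex.cpow_add _ _ hk', Complex.cpow_add _ _ hl',
    Complex.cpow_add _ _ hu', Complex.cpow_add _ _ hv', h3 l z hl', h3 l w hl', h3 u w hu', h3 v z hv']
  simp only [Pi.one_apply]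
  push_cast
  rw [one_div_div]
  ring

/-- The Dirichlet series of the weights. -/
theorem hasSum_weight {z w : ℂ} (hz : 0 < z.re) (hw : 0 < w.re) (hzw : 1 < (z + w).re) :
    HasSum (fun t => (weight t : ℂ) / ((indexOne t : ℂ) ^ z * (indexTwo t : ℂ) ^ w))
      (riemannZeta (z + w) * riemannZeta (2 * z + 2 * w - 1) /
        (riemannZeta (z + 2 * w) * riemannZeta (2 * z + w))) := by
  have hz0 : z ≠ 0 := by rintro rfl; simp at hz
  simp only [weight_div_eq_mul hz0]
  have h1 : 1 < (2 * z + 2 * w - 1).re := by simp at hzw ⊢; linarith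
  have h2 : 1 < (z + 2 * w).re := by simp at hzw ⊢; linarith
  have h3 : 1 < (2 * z + w).re := by simp at hzw ⊢; linarith
  have h := (LSeriesHasSum_one hzw).mul_complex ((LSeriesHasSum_one h1).mul_complex
    ((hasSum_moebius h2).mul_complex (hasSum_moebius h3)))
  convert h using 1
  rw [div_eq_mul_inv, mul_inv, mul_assoc]

/-- Summation by the substitution `m = a r(t)`, `n = b s(t)`. -/
lemma hasSum_of_mul_index {γ : Type*} {r s : γ → ℕ} {f g : (ℕ × ℕ) × γ → ℂ} {S : ℂ}
    (hf : HasSum f S) (hfs : ∀ a b t, f ((a, b), t) ≠ 0 → r t ≠ 0 ∧ s t ≠ 0)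
    (hgs : ∀ m n t, g ((m, n), t) ≠ 0 → r t ∣ m ∧ s t ∣ n ∧ m ≠ 0 ∧ n ≠ 0)
    (hmul : ∀ a b t, r t ≠ 0 → s t ≠ 0 → g ((a * r t, b * s t), t) = f ((a, b), t)) :
    HasSum g S := by
  refine (hasSum_iff_hasSum_of_ne_zero_bij
    (fun x : Function.support g => ((x.1.1.1 / r x.1.2, x.1.1.2 / s x.1.2), x.1.2)) ?_ ?_ ?_).1 hf
  · rintro ⟨⟨⟨m, n⟩, t⟩, hx⟩ ⟨⟨⟨m', n'⟩, t'⟩, hx'⟩ heq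
    obtain ⟨⟨a, rfl⟩, ⟨b, rfl⟩, h3, h4⟩ := hgs _ _ _ hx
    obtain ⟨⟨a', rfl⟩, ⟨b', rfl⟩, -, -⟩ := hgs _ _ _ hx'
    simp only [Prod.mk.injEq] at heq
    obtain ⟨⟨e1, e2⟩, rfl⟩ := heq
    have h1 := Nat.pos_of_ne_zero (left_ne_zero_of_mul h3)
    have h2 := Nat.pos_of_ne_zero (left_ne_zero_of_mul h4)
    rw [Nat.mul_div_cancel_left _ h1, Nat.mul_div_cancel_left _ h1] at e1
    rw [Nat.mul_div_cancel_left _ h2, Nat.mul_div_cancel_left _ h2] at e2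
    subst e1 e2
    rfl
  · rintro ⟨⟨a, b⟩, t⟩ hx
    obtain ⟨h1, h2⟩ := hfs _ _ _ hx
    refine ⟨⟨((a * r t, b * s t), t), ?_⟩, ?_⟩
    · rw [Function.mem_support, hmul a b t h1 h2]
      exact hx
    · simp only [Nat.mul_div_cancel _ (Nat.pos_of_ne_zero h1),
        Nat.mul_div_cancel _ (Nat.pos_of_ne_zero h2)]
  · rintro ⟨⟨⟨m, n⟩, t⟩, hx⟩
    obtain ⟨⟨a, rfl⟩, ⟨b, rfl⟩, h3, h4⟩ := hgs _ _ _ hx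
    have h1 := left_ne_zero_of_mul h3
    have h2 := left_ne_zero_of_mul h4
    simp only
    rw [Nat.mul_div_cancel_left _ (Nat.pos_of_ne_zero h1),
      Nat.mul_div_cancel_left _ (Nat.pos_of_ne_zero h2), ← hmul a b t h1 h2, mul_comm a, mul_comm b]

/-- Multiply the two `τ` series by the weight series, substitute `m = a r(t)`, `n = b s(t)`, and sum
over `t` with `(m, n)` fixed. -/
lemma hasSum_nat_numSubrings {z w : ℂ} (hz : 1 < z.re) (hw : 1 < w.re) :
    HasSum (fun p : ℕ × ℕ => (numSubrings p.1 p.2 : ℂ) / ((p.1 : ℂ) ^ z * (p.2 : ℂ) ^ w))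
      (riemannZeta z ^ 2 * riemannZeta w ^ 2 * (riemannZeta (z + w) *
        riemannZeta (2 * z + 2 * w - 1) / (riemannZeta (z + 2 * w) * riemannZeta (2 * z + w)))) := by
  have hz0 : z ≠ 0 := by rintro rfl; simp at hz; linarith
  have hw0 : w ≠ 0 := by rintro rfl; simp at hw; linarith
  have hf := ((hasSum_card_divisors hz).mul_complex (hasSum_card_divisors hw)).mul_complex
    (hasSum_weight (z := z) (w := w) (by linarith) (by linarith)
      (by rw [Complex.add_re]; linarith))
  have hg := hasSum_of_mul_index (r := indexOne) (s := indexTwo) (g := fun x =>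
    (if indexOne x.2 ∣ x.1.1 ∧ indexTwo x.2 ∣ x.1.2 then
      (weight x.2 : ℂ) * ((x.1.1 / indexOne x.2).divisors.card *
        (x.1.2 / indexTwo x.2).divisors.card) else 0) / ((x.1.1 : ℂ) ^ z * (x.1.2 : ℂ) ^ w))
    hf ?_ ?_ ?_
  · refine hg.prod_fiberwise fun p => ?_
    -- Terms with `m = 0` or `n = 0` vanish because their denominator is `0`.
    rcases Nat.eq_zero_or_pos p.1 with h1 | h1
    · simp [h1, hz0, hasSum_zero]
    rcases Nat.eq_zero_or_pos p.2 with h2 | h2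
    · simp [h2, hw0, hasSum_zero]
    have h3 := hasSum_weight_numSubrings ℂ h1 h2
    have h4 := h3.div_const ((p.1 : ℂ) ^ z * (p.2 : ℂ) ^ w)
    exact h4
  · intro a b t h
    refine ⟨fun h1 => h ?_, fun h1 => h ?_⟩
    · simp [h1, hz0]
    · simp [h1, hw0]
  · intro m n t h
    by_cases h0 : indexOne t ∣ m ∧ indexTwo t ∣ n
    · refine ⟨h0.1, h0.2, ?_, ?_⟩
      · rintro rfl
        simp [hz0] at h
      · rintro rfl
        simp [hw0] at h
    · simp only [if_neg h0, zero_div, ne_eq, not_true_eq_false] at h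
  · intro a b t h1 h2
    simp only [dvd_mul_left, and_self, if_true, Nat.mul_div_cancel _ (Nat.pos_of_ne_zero h1),
      Nat.mul_div_cancel _ (Nat.pos_of_ne_zero h2), Nat.cast_mul,
      Complex.natCast_mul_natCast_cpow]
    ring

theorem hasSum_numSubrings {z w : ℂ} (hz : 1 < z.re) (hw : 1 < w.re) :
    HasSum (fun p : ℕ+ × ℕ+ =>
        (numSubrings p.1 p.2 : ℂ) / (((p.1 : ℕ) : ℂ) ^ z * ((p.2 : ℕ) : ℂ) ^ w))
      (riemannZeta z ^ 2 * riemannZeta w ^ 2 * riemannZeta (z + w) *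
          riemannZeta (2 * z + 2 * w - 1) /
        (riemannZeta (z + 2 * w) * riemannZeta (2 * z + w))) := by
  have hz0 : z ≠ 0 := by rintro rfl; simp at hz; linarith
  have hw0 : w ≠ 0 := by rintro rfl; simp at hw; linarith
  have h := hasSum_nat_numSubrings hz hw
  rw [← mul_div_assoc, ← mul_assoc] at h
  refine (Function.Injective.hasSum_iff (g := fun p : ℕ+ × ℕ+ => ((p.1 : ℕ), (p.2 : ℕ))) ?_ ?_).2 h
  · rintro ⟨a, b⟩ ⟨a', b'⟩ h
    simpa using h
  · rintro ⟨m, n⟩ hp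
    rcases Nat.eq_zero_or_pos m with rfl | h1
    · simp [hz0]
    rcases Nat.eq_zero_or_pos n with rfl | h2
    · simp [hw0]
    exact absurd ⟨(⟨m, h1⟩, ⟨n, h2⟩), rfl⟩ hp

end DoubleSeries

/-! ### The Dirichlet divisor problem: `0 ≤ θ ≤ 1/2` and uniform bounds -/

section DivisorProblem

open Finset

lemma card_filter_mul_le {N a : ℕ} (ha : 0 < a) :
    ((Icc 1 N).filter fun b => a * b ≤ N).card = N / a := by
  have : ((Icc 1 N).filter fun b => a * b ≤ N) = Icc 1 (N / a) := by
    ext b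
    simp only [mem_filter, mem_Icc, Nat.le_div_iff_mul_le ha, mul_comm b]
    constructor
    · rintro ⟨⟨h1, -⟩, h2⟩
      exact ⟨h1, h2⟩
    · rintro ⟨h1, h2⟩
      exact ⟨⟨h1, (Nat.le_mul_of_pos_left b ha).trans h2⟩, h2⟩
  rw [this, Nat.card_Icc, Nat.add_sub_cancel]

lemma sum_card_divisors_eq_card (N : ℕ) :
    ∑ n ∈ Icc 1 N, n.divisors.card =
      ((Icc 1 N ×ˢ Icc 1 N).filter fun p => p.1 * p.2 ≤ N).card := by
  have h := ArithmeticFunction.sum_Ioc_sigma0_eq_sum_div N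
  simp only [ArithmeticFunction.sigma_zero_apply] at h
  rw [card_filter, sum_product]
  simp only [← card_filter]
  rw [sum_congr rfl fun a ha => card_filter_mul_le (mem_Icc.1 ha).1]
  exact h

/-- Dirichlet's hyperbola method for the number of divisors. -/
lemma sum_card_divisors_add_sqrt_sq (N : ℕ) :
    ∑ n ∈ Icc 1 N, n.divisors.card + N.sqrt ^ 2 = 2 * ∑ a ∈ Icc 1 N.sqrt, N / a := by
  set s := N.sqrt with hs
  set S := (Icc 1 N ×ˢ Icc 1 N).filter fun p => p.1 * p.2 ≤ N with hS
  have hsN : s ≤ N := Nat.sqrt_le_self N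
  have h1 : S = S.filter (fun p => p.1 ≤ s) ∪ S.filter (fun p => p.2 ≤ s) := by
    rw [← filter_or]
    symm
    refine filter_true_of_mem ?_
    rintro ⟨a, b⟩ h
    simp only [hS, mem_filter] at h
    by_contra! hc
    have h2 : (s + 1) * (s + 1) ≤ a * b := Nat.mul_le_mul hc.1 hc.2
    have h3 : N < (s + 1) * (s + 1) := Nat.lt_succ_sqrt N
    have h4 := h.2
    omega
  have h2 : S.filter (fun p => p.1 ≤ s) ∩ S.filter (fun p => p.2 ≤ s) = Icc 1 s ×ˢ Icc 1 s := by
    ext ⟨a, b⟩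
    simp only [hS, mem_inter, mem_filter, mem_product, mem_Icc]
    constructor
    · rintro ⟨⟨h1, h2⟩, h3, h4⟩
      exact ⟨⟨h1.1.1.1, h2⟩, h1.1.2.1, h4⟩
    · rintro ⟨⟨h1, h2⟩, h3, h4⟩
      have h5 : a * b ≤ N := (Nat.mul_le_mul h2 h4).trans (Nat.sqrt_le N)
      exact ⟨⟨⟨⟨⟨h1, h2.trans hsN⟩, h3, h4.trans hsN⟩, h5⟩, h2⟩,
        ⟨⟨⟨h1, h2.trans hsN⟩, h3, h4.trans hsN⟩, h5⟩, h4⟩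
  have h3 : (S.filter fun p => p.1 ≤ s).card = ∑ a ∈ Icc 1 s, N / a := by
    have : (S.filter fun p => p.1 ≤ s).card =
        ((Icc 1 s).sigma fun a => (Icc 1 N).filter fun b => a * b ≤ N).card := by
      refine card_nbij' (fun p => ⟨p.1, p.2⟩) (fun p => (p.1, p.2)) ?_ ?_ ?_ ?_
      · rintro ⟨a, b⟩ h
        simp only [hS, mem_coe, mem_filter, mem_product, mem_Icc, mem_sigma] at h ⊢
        tauto
      · rintro ⟨a, b⟩ h
        simp only [hS, mem_coe, mem_filter, mem_product, mem_Icc, mem_sigma] at h ⊢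
        exact ⟨⟨⟨⟨h.1.1, h.1.2.trans hsN⟩, h.2.1⟩, h.2.2⟩, h.1.2⟩
      · exact fun _ _ => rfl
      · exact fun _ _ => rfl
    rw [this, card_sigma]
    exact sum_congr rfl fun a ha => card_filter_mul_le (mem_Icc.1 ha).1
  have h4 : (S.filter fun p => p.2 ≤ s).card = (S.filter fun p => p.1 ≤ s).card := by
    refine card_nbij' Prod.swap Prod.swap ?_ ?_ ?_ ?_
    · rintro ⟨a, b⟩ h
      simp only [hS, mem_coe, mem_filter, mem_product, Prod.swap, mul_comm b a] at h ⊢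
      tauto
    · rintro ⟨a, b⟩ h
      simp only [hS, mem_coe, mem_filter, mem_product, Prod.swap, mul_comm b a] at h ⊢
      tauto
    · exact fun _ _ => rfl
    · exact fun _ _ => rfl
  have h5 := card_union_add_card_inter (S.filter fun p => p.1 ≤ s) (S.filter fun p => p.2 ≤ s)
  rw [← h1, h2, h4, h3, card_product, Nat.card_Icc, Nat.add_sub_cancel] at h5
  rw [sum_card_divisors_eq_card, sq, two_mul, ← h5]

/-- Euler's constant lies between `H_n - log (n + 1)` and `H_n - log n`, which differ by at most `1
/ n`. -/
lemma abs_harmonic_sub_le {n : ℕ} {y : ℝ} (hn : 1 ≤ n) (h1 : n ≤ y) (h2 : y ≤ n + 1) :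
    |(harmonic n : ℝ) - Real.log y - Real.eulerMascheroniConstant| ≤ 1 / n := by
  have hn0 : (0 : ℝ) < n := by exact_mod_cast hn
  have e1 := Real.eulerMascheroniSeq_lt_eulerMascheroniConstant n
  have e2 := Real.eulerMascheroniConstant_lt_eulerMascheroniSeq' n
  rw [Real.eulerMascheroniSeq] at e1
  rw [Real.eulerMascheroniSeq', if_neg (by omega)] at e2
  have l1 : Real.log n ≤ Real.log y := Real.log_le_log hn0 h1
  have l2 : Real.log y ≤ Real.log (n + 1) := Real.log_le_log (by linarith) h2
  have l3 : Real.log (n + 1) - Real.log n ≤ 1 / n := by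
    rw [← Real.log_div (by positivity) (by positivity)]
    have := Real.log_le_sub_one_of_pos (show (0 : ℝ) < (n + 1) / n by positivity)
    rw [add_div, div_self hn0.ne'] at this ⊢
    linarith
  rw [abs_le]
  constructor <;> linarith

/-- In the hyperbola formula with `n = ⌊√x⌋`, dropping floors costs at most `2 n`, replacing `H_n`
by `log √x + γ` costs `2 x / n ≤ 4 √x`, and `x - n²` is `O(√x)`. -/
lemma abs_divisorError_le {x : ℝ} (hx : 1 ≤ x) : |divisorError x| ≤ 9 * √x := by
  set N := ⌊x⌋₊ with hN
  set n := N.sqrt with hn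
  have hx0 : 0 < x := by linarith
  have hN1 : 1 ≤ N := Nat.one_le_floor_iff _ |>.2 hx
  have hn1 : 1 ≤ n := Nat.sqrt_pos.2 hN1
  have hNx : (N : ℝ) ≤ x := Nat.floor_le hx0.le
  have hxN : x < N + 1 := Nat.lt_floor_add_one x
  have h1 : ((n : ℝ)) ^ 2 ≤ x := by
    refine le_trans ?_ hNx
    rw [sq]
    exact_mod_cast Nat.sqrt_le N
  have h2 : x < ((n : ℝ) + 1) ^ 2 := by
    refine hxN.trans_le ?_
    rw [sq]
    exact_mod_cast Nat.lt_succ_sqrt N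
  have hn0 : (1 : ℝ) ≤ n := by exact_mod_cast hn1
  have hy0 : 0 < √x := Real.sqrt_pos.2 hx0
  have hy2 : √x * √x = x := Real.mul_self_sqrt hx0.le
  have h3 : (n : ℝ) ≤ √x := Real.le_sqrt_of_sq_le h1
  have h4 : √x ≤ n + 1 := (Real.sqrt_lt' (by positivity)).2 h2 |>.le
  have hH := abs_harmonic_sub_le hn1 h3 h4
  have hlog : Real.log √x = Real.log x / 2 := Real.log_sqrt hx0.le
  have hsum := sum_card_divisors_add_sqrt_sq N
  have hsum' : (∑ n ∈ Icc 1 N, (n.divisors.card : ℝ)) =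
      2 * (∑ a ∈ Icc 1 n, ((N / a : ℕ) : ℝ)) - (n : ℝ) ^ 2 := by
    rw [eq_sub_iff_add_eq]
    exact_mod_cast hsum
  have hharm : (harmonic n : ℝ) = ∑ a ∈ Icc 1 n, (a : ℝ)⁻¹ := by
    rw [harmonic_eq_sum_Icc]
    push_cast
    rfl
  have hlow : x * harmonic n - n ≤ ∑ a ∈ Icc 1 n, ((N / a : ℕ) : ℝ) := by
    have : x * harmonic n - n = ∑ a ∈ Icc 1 n, (x * (a : ℝ)⁻¹ - 1) := by
      rw [sum_sub_distrib, ← mul_sum, hharm]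
      simp
    rw [this]
    refine sum_le_sum fun a ha => ?_
    rw [hN, ← Nat.floor_div_natCast, ← div_eq_mul_inv]
    have := Nat.lt_floor_add_one (x / a)
    linarith
  have hup : ∑ a ∈ Icc 1 n, ((N / a : ℕ) : ℝ) ≤ x * harmonic n := by
    rw [hharm, mul_sum]
    refine sum_le_sum fun a ha => ?_
    rw [hN, ← Nat.floor_div_natCast, ← div_eq_mul_inv]
    exact Nat.floor_le (by positivity)
  have hxn : x * (1 / n) ≤ 2 * √x := by
    rw [mul_one_div, div_le_iff₀ (by linarith)]
    nlinarith
  rw [abs_le] at hH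
  have m1 := mul_le_mul_of_nonneg_left hH.1 hx0.le
  have m2 := mul_le_mul_of_nonneg_left hH.2 hx0.le
  rw [hlog] at m1 m2
  rw [divisorError, ← hN, hsum', abs_le]
  constructor <;> nlinarith

lemma isDivisorAdmissible_one_half : IsDivisorAdmissible (1 / 2) := by
  intro ε hε
  refine IsBigO.of_bound 9 ?_
  filter_upwards [eventually_ge_atTop 1] with x hx
  have hx0 : 0 < x := by linarith
  rw [Real.norm_eq_abs, Real.norm_of_nonneg (by positivity)]
  refine (abs_divisorError_le hx).trans ?_
  rw [Real.sqrt_eq_rpow]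
  gcongr
  linarith

/-- A negative exponent would force `Δ → 0`. But between `n` and `n + 1/2` the divisor sum is
constant while the main term grows by at least `(log n) / 2`. -/
lemma nonneg_of_isDivisorAdmissible {θ : ℝ} (h : IsDivisorAdmissible θ) : 0 ≤ θ := by
  by_contra! hθ
  have h1 := h (-θ / 2) (by linarith)
  rw [show θ + -θ / 2 = -(-θ / 2) by ring] at h1
  have h2 : Tendsto divisorError atTop (nhds 0) :=
    h1.trans_tendsto (tendsto_rpow_neg_atTop (by linarith))
  have h3 : Tendsto (fun n : ℕ => divisorError n - divisorError (n + 1 / 2)) atTop (nhds 0) := by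
    have h4 := h2.comp (tendsto_natCast_atTop_atTop (R := ℝ))
    have h5 := h2.comp (tendsto_atTop_add_const_right _ (1 / 2 : ℝ)
      (tendsto_natCast_atTop_atTop (R := ℝ)))
    simpa using h4.sub h5
  have h4 : ∀ᶠ n : ℕ in atTop, (1 / 2 : ℝ) ≤ divisorError n - divisorError (n + 1 / 2) := by
    filter_upwards [eventually_ge_atTop 3] with n hn
    have hn3 : (3 : ℝ) ≤ n := by exact_mod_cast hn
    have hfl : ⌊(n : ℝ) + 1 / 2⌋₊ = n := by
      rw [Nat.floor_eq_iff (by positivity)]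
      constructor <;> linarith
    have hlog1 : 1 ≤ Real.log n := by
      rw [Real.le_log_iff_exp_le (by linarith)]
      linarith [Real.exp_one_lt_d9]
    have hlog2 : Real.log n ≤ Real.log (n + 1 / 2) := Real.log_le_log (by linarith) (by linarith)
    have hγ := Real.one_half_lt_eulerMascheroniConstant
    simp only [divisorError, Nat.floor_natCast, hfl]
    nlinarith
  have := ge_of_tendsto h3 h4
  norm_num at this

lemma bddBelow_isDivisorAdmissible : BddBelow {θ : ℝ | IsDivisorAdmissible θ} :=
  ⟨0, fun _ h => nonneg_of_isDivisorAdmissible h⟩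

lemma divisorExponent_nonneg : 0 ≤ divisorExponent :=
  Real.sInf_nonneg fun _ h => nonneg_of_isDivisorAdmissible h

lemma divisorExponent_le_one_half : divisorExponent ≤ 1 / 2 :=
  csInf_le bddBelow_isDivisorAdmissible isDivisorAdmissible_one_half

lemma divisorError_isBigO {β : ℝ} (hβ : divisorExponent < β) :
    divisorError =O[atTop] fun x : ℝ => x ^ β := by
  obtain ⟨θ, hθ, hlt⟩ := exists_lt_of_csInf_lt ⟨1 / 2, isDivisorAdmissible_one_half⟩ hβ
  have h := hθ (β - θ) (by linarith)
  rwa [add_sub_cancel] at h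

/-- The summatory function of the number of divisors. -/
noncomputable def divisorSum (x : ℝ) : ℝ := ∑ n ∈ Icc 1 ⌊x⌋₊, (n.divisors.card : ℝ)

/-- The main term of the summatory function of the number of divisors. -/
noncomputable def divisorMain (x : ℝ) : ℝ :=
  x * Real.log x + (2 * Real.eulerMascheroniConstant - 1) * x

lemma divisorSum_eq (x : ℝ) : divisorSum x = divisorMain x + divisorError x := by
  rw [divisorError, divisorSum, divisorMain]
  ring

lemma divisorSum_of_lt_one {x : ℝ} (hx : x < 1) : divisorSum x = 0 := by
  rw [divisorSum, Nat.floor_eq_zero.2 hx]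
  simp

lemma abs_divisorMain_le {δ y : ℝ} (hδ : 0 < δ) (hy : 0 < y) :
    |divisorMain y| ≤ y * ((y ^ δ + y ^ (-δ)) / δ + 1) := by
  have h1 := Real.log_le_rpow_div hy.le hδ
  have h2 := Real.log_le_rpow_div (inv_nonneg.2 hy.le) hδ
  rw [Real.log_inv, Real.inv_rpow hy.le, ← Real.rpow_neg hy.le] at h2
  have h3 : 0 ≤ y ^ δ / δ := by positivity
  have h4 : 0 ≤ y ^ (-δ) / δ := by positivity
  have hγ := Real.one_half_lt_eulerMascheroniConstant
  have hγ' := Real.eulerMascheroniConstant_lt_two_thirds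
  have h5 : divisorMain y = y * (Real.log y + (2 * Real.eulerMascheroniConstant - 1)) := by
    rw [divisorMain]; ring
  rw [h5, abs_mul, abs_of_pos hy]
  refine mul_le_mul_of_nonneg_left ?_ hy.le
  rw [add_div, abs_le]
  constructor <;> linarith

/-- The two powers absorb the logarithm both at infinity and at `0`; small arguments occur because
the sum over quadruples is not truncated. -/
lemma exists_abs_divisorMain_le {δ : ℝ} (hδ : 0 < δ) :
    ∃ C : ℝ, 0 ≤ C ∧ ∀ y : ℝ, 0 ≤ y → |divisorMain y| ≤ C * (y ^ (1 + δ) + y ^ (1 - δ)) := by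
  refine ⟨1 / δ + 1, by positivity, fun y hy => ?_⟩
  rcases hy.eq_or_lt with rfl | hy
  · simp only [divisorMain, zero_mul, mul_zero, add_zero, abs_zero]
    have := Real.zero_rpow_nonneg (1 + δ)
    have := Real.zero_rpow_nonneg (1 - δ)
    positivity
  · refine (abs_divisorMain_le hδ hy).trans ?_
    have e1 : y ^ (1 + δ) = y * y ^ δ := by rw [Real.rpow_add hy, Real.rpow_one]
    have e2 : y ^ (1 - δ) = y * y ^ (-δ) := by rw [sub_eq_add_neg, Real.rpow_add hy, Real.rpow_one]
    have e3 : y ^ δ * y ^ (-δ) = 1 := by rw [← Real.rpow_add hy]; simp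
    have p1 : 0 < y ^ δ := by positivity
    have p2 : 0 < y ^ (-δ) := by positivity
    -- Two positive numbers with product `1` have sum at least `1`; this absorbs the constant term.
    have e4 : 1 ≤ y ^ δ + y ^ (-δ) := by nlinarith [sq_nonneg (y ^ δ - y ^ (-δ))]
    rw [e1, e2, ← mul_add, mul_left_comm]
    refine mul_le_mul_of_nonneg_left ?_ hy.le
    rw [add_mul, one_mul, one_div_mul_eq_div]
    linarith

/-- Below `1` the error is minus the main term, and `y |log y|` is `O(y ^ β)` because `β < 1`. From
some `Y` on the asymptotic bound applies, and on `[1, Y)` the error is bounded while `y ^ β ≥ 1`. -/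
lemma exists_abs_divisorError_le {β : ℝ} (hβ : divisorExponent < β) (hβ1 : β < 1) :
    ∃ C : ℝ, 0 ≤ C ∧ ∀ y : ℝ, 0 ≤ y → |divisorError y| ≤ C * y ^ β := by
  have hβ0 : 0 < β := divisorExponent_nonneg.trans_lt hβ
  obtain ⟨c, hc, hb⟩ := (divisorError_isBigO hβ).exists_pos
  obtain ⟨Y₀, hY₀⟩ := eventually_atTop.1 hb.bound
  set Y := max Y₀ 1 with hY
  have hY1 : 1 ≤ Y := le_max_right _ _
  have hγ := Real.one_half_lt_eulerMascheroniConstant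
  have hγ' := Real.eulerMascheroniConstant_lt_two_thirds
  have hlogY : 0 ≤ Real.log Y := Real.log_nonneg hY1
  have hDY : 0 ≤ divisorSum Y := sum_nonneg fun _ _ => Nat.cast_nonneg _
  have hb1 : 0 < 1 - β := by linarith
  refine ⟨c + (1 / (1 - β) + 1) + (divisorSum Y + Y * Real.log Y + Y), by positivity, fun y hy => ?_⟩
  rcases hy.eq_or_lt with rfl | hy
  · simp [divisorError, Real.zero_rpow hβ0.ne']
  have hyβ : 0 < y ^ β := by positivity
  rcases lt_or_ge y 1 with hy1 | hy1
  · have e1 : |divisorError y| ≤ (1 / (1 - β) + 1) * y ^ β := by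
      have h1 := (Real.abs_log_mul_self_rpow_lt y (1 - β) hy hy1.le hb1).le
      have h2 : divisorError y = -divisorMain y := by
        have := divisorSum_eq y
        rw [divisorSum_of_lt_one hy1] at this
        linarith
      have h3 : y ^ (1 - β) * y ^ β = y := by rw [← Real.rpow_add hy]; simp
      have h4 : y ^ (1 - β) ≤ 1 := Real.rpow_le_one hy.le hy1.le hb1.le
      have h5 : 0 < y ^ (1 - β) := by positivity
      have h6 : divisorMain y = (Real.log y * y ^ (1 - β) +
          (2 * Real.eulerMascheroniConstant - 1) * y ^ (1 - β)) * y ^ β := by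
        rw [divisorMain]
        linear_combination (-Real.log y - (2 * Real.eulerMascheroniConstant - 1)) * h3
      rw [h2, abs_neg, h6, abs_mul, abs_of_pos hyβ]
      refine mul_le_mul_of_nonneg_right ?_ hyβ.le
      refine (abs_add_le _ _).trans (add_le_add h1 ?_)
      rw [abs_of_nonneg (mul_nonneg (by linarith) h5.le)]
      nlinarith
    refine e1.trans (mul_le_mul_of_nonneg_right ?_ hyβ.le)
    have : 0 ≤ divisorSum Y + Y * Real.log Y + Y := by positivity
    linarith
  rcases le_or_gt Y y with hyY | hyY
  · have h1 := hY₀ y ((le_max_left _ _).trans hyY)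
    rw [Real.norm_eq_abs, Real.norm_of_nonneg hyβ.le] at h1
    refine h1.trans (mul_le_mul_of_nonneg_right ?_ hyβ.le)
    have : 0 ≤ (1 / (1 - β) + 1) + (divisorSum Y + Y * Real.log Y + Y) := by positivity
    linarith
  · have h1 : 1 ≤ y ^ β := Real.one_le_rpow hy1 hβ0.le
    have h2 : divisorSum y ≤ divisorSum Y := by
      refine sum_le_sum_of_subset_of_nonneg ?_ fun _ _ _ => Nat.cast_nonneg _
      exact Icc_subset_Icc le_rfl (Nat.floor_mono hyY.le)
    have h3 : 0 ≤ divisorSum y := sum_nonneg fun _ _ => Nat.cast_nonneg _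
    have h4 : 0 ≤ Real.log y := Real.log_nonneg hy1
    have h5 : Real.log y ≤ Real.log Y := Real.log_le_log hy hyY.le
    have h6 : y * Real.log y ≤ Y * Real.log Y := mul_le_mul hyY.le h5 h4 (by linarith)
    have h7 : 0 ≤ y * Real.log y := by positivity
    have h8 : |divisorError y| ≤ divisorSum Y + Y * Real.log Y + Y := by
      have := divisorSum_eq y
      rw [divisorMain] at this
      rw [abs_le]
      constructor <;> nlinarith
    refine h8.trans ?_
    have h9 : 0 ≤ c + (1 / (1 - β) + 1) := by positivity
    have h10 : 0 ≤ divisorSum Y + Y * Real.log Y + Y := by positivity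
    nlinarith

end DivisorProblem

/-! ### The asymptotic formula -/

section Asymptotic

open Finset

lemma sum_filter_dvd_card_divisors {x : ℝ} (r : ℕ) :
    ∑ m ∈ Icc 1 ⌊x⌋₊ with r ∣ m, ((m / r).divisors.card : ℝ) = divisorSum (x / r) := by
  rw [divisorSum, Nat.floor_div_natCast]
  rcases Nat.eq_zero_or_pos r with rfl | hr
  · rw [filter_false_of_mem]
    · simp
    · intro m hm h
      have := (mem_Icc.1 hm).1
      rw [zero_dvd_iff] at h
      omega
  symm
  refine sum_bij (fun a _ => r * a) ?_ ?_ ?_ ?_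
  · intro a ha
    rw [mem_Icc] at ha
    rw [mem_filter, mem_Icc]
    refine ⟨⟨Nat.mul_pos hr ha.1, ?_⟩, dvd_mul_right _ _⟩
    rw [mul_comm]
    exact (Nat.le_div_iff_mul_le hr).1 ha.2
  · exact fun a _ b _ h => Nat.eq_of_mul_eq_mul_left hr h
  · intro m hm
    rw [mem_filter, mem_Icc] at hm
    obtain ⟨⟨h1, h2⟩, a, rfl⟩ := hm
    refine ⟨a, ?_, rfl⟩
    rw [mem_Icc, Nat.le_div_iff_mul_le hr, mul_comm a]
    exact ⟨Nat.pos_of_mul_pos_left h1, h2⟩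
  · intro a _
    rw [Nat.mul_div_cancel_left _ hr]

theorem hasSum_weight_divisorSum (x : ℝ) :
    HasSum (fun t => (weight t : ℝ) *
        (divisorSum (x / indexOne t) * divisorSum (x / indexTwo t)))
      (∑ m ∈ Icc 1 ⌊x⌋₊, ∑ n ∈ Icc 1 ⌊x⌋₊, (numSubrings m n : ℝ)) := by
  have h : HasSum (fun t => ∑ m ∈ Icc 1 ⌊x⌋₊, ∑ n ∈ Icc 1 ⌊x⌋₊,
      if indexOne t ∣ m ∧ indexTwo t ∣ n then (weight t : ℝ) *
        ((m / indexOne t).divisors.card * (n / indexTwo t).divisors.card) else 0)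
      (∑ m ∈ Icc 1 ⌊x⌋₊, ∑ n ∈ Icc 1 ⌊x⌋₊, (numSubrings m n : ℝ)) := by
    refine hasSum_sum fun m hm => hasSum_sum fun n hn => ?_
    have h3 := hasSum_weight_numSubrings ℝ (mem_Icc.1 hm).1 (mem_Icc.1 hn).1
    exact h3
  convert h using 2 with t
  rw [← sum_filter_dvd_card_divisors, ← sum_filter_dvd_card_divisors, sum_mul_sum, mul_sum,
    sum_filter]
  refine sum_congr rfl fun m _ => ?_
  rw [mul_sum, sum_filter]
  by_cases h1 : indexOne t ∣ m
  · simp [h1]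
  · simp [h1]

/-- Absolute convergence at real exponents; only the sum must exceed `1`, so one exponent may be as
small as `β`. -/
lemma summable_abs_weight {α β : ℝ} (hα : 0 < α) (hβ : 0 < β) (h : 1 < α + β) :
    Summable fun t => |(weight t : ℝ)| / ((indexOne t : ℝ) ^ α * (indexTwo t : ℝ) ^ β) := by
  have hs := (hasSum_weight (z := α) (w := β) (by simpa) (by simpa) (by simpa)).summable.norm
  convert hs using 2 with t
  rw [norm_div, norm_mul, Complex.norm_natCast_cpow_of_re_ne_zero _ (by simpa using hα.ne'),
    Complex.norm_natCast_cpow_of_re_ne_zero _ (by simpa using hβ.ne')]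
  simp

/-- The terms `∑_t |w(t)| (x / r(t))^α (x / s(t))^β`. -/
lemma hasSum_abs_weight_mul {α β x : ℝ} (hα : 0 < α) (hβ : 0 < β) (h : 1 < α + β) (hx : 0 < x) :
    HasSum (fun t => |(weight t : ℝ)| * ((x / indexOne t) ^ α * (x / indexTwo t) ^ β))
      (x ^ (α + β) *
        ∑' t, |(weight t : ℝ)| / ((indexOne t : ℝ) ^ α * (indexTwo t : ℝ) ^ β)) := by
  have hs := (summable_abs_weight hα hβ h).hasSum.mul_left (x ^ (α + β))
  have e : ∀ t, |(weight t : ℝ)| * ((x / indexOne t) ^ α * (x / indexTwo t) ^ β) =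
      x ^ (α + β) * (|(weight t : ℝ)| / ((indexOne t : ℝ) ^ α * (indexTwo t : ℝ) ^ β)) := by
    intro t
    rw [Real.div_rpow hx.le (Nat.cast_nonneg _), Real.div_rpow hx.le (Nat.cast_nonneg _),
      Real.rpow_add hx]
    ring
  simp only [e]
  exact hs

lemma rpow_mul_isBigO {a b K : ℝ} (hab : a ≤ b) :
    (fun x : ℝ => x ^ a * K) =O[atTop] fun x : ℝ => x ^ b := by
  refine IsBigO.of_bound |K| ?_
  filter_upwards [eventually_ge_atTop 1] with x hx
  have hx0 : 0 < x := by linarith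
  rw [norm_mul, Real.norm_of_nonneg (by positivity : 0 ≤ x ^ a),
    Real.norm_of_nonneg (by positivity : 0 ≤ x ^ b), Real.norm_eq_abs, mul_comm]
  gcongr

/-- The contribution of the error term of the divisor problem. -/
lemma isBigO_error {ε : ℝ} (hε : 0 < ε) (hε1 : ε < 1 / 2) :
    (fun x : ℝ => ∑' t, (weight t : ℝ) *
      (divisorSum (x / indexOne t) * divisorSum (x / indexTwo t) -
        divisorMain (x / indexOne t) * divisorMain (x / indexTwo t)))
      =O[atTop] fun x : ℝ => x ^ (1 + divisorExponent + ε) := by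
  have hθ0 := divisorExponent_nonneg
  have hθ1 := divisorExponent_le_one_half
  -- Then `β + 1 + δ ≤ 1 + θ + ε`, while `δ < β` keeps `β + 1 - δ > 1`; `θ ≤ 1/2` and `ε < 1/2` give
  -- `β < 1`.
  set β := divisorExponent + ε / 2 with hβ
  set δ := ε / 4 with hδ
  have hβ1 : β < 1 := by linarith
  have hβ0 : 0 < β := by linarith
  have hδ0 : 0 < δ := by linarith
  obtain ⟨C, hC0, hC⟩ := exists_abs_divisorError_le (β := β) (by linarith) hβ1
  obtain ⟨C', hC0', hC'⟩ := exists_abs_divisorMain_le hδ0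
  have hD : ∀ y : ℝ, 0 ≤ y → |divisorSum y| ≤ (C + C') * (y ^ (1 + δ) + y ^ (1 - δ)) := by
    intro y hy
    have p1 : 0 ≤ y ^ (1 + δ) := by positivity
    have p2 : 0 ≤ y ^ (1 - δ) := by positivity
    rcases lt_or_ge y 1 with hy1 | hy1
    · rw [divisorSum_of_lt_one hy1, abs_zero]
      positivity
    · rw [divisorSum_eq, add_mul, add_comm]
      refine (abs_add_le _ _).trans (add_le_add ?_ (hC' y hy))
      refine (hC y hy).trans (mul_le_mul_of_nonneg_left ?_ hC0)
      have : y ^ β ≤ y ^ (1 + δ) := Real.rpow_le_rpow_of_exponent_le hy1 (by linarith)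
      linarith
  have hterm : ∀ y y' : ℝ, 0 ≤ y → 0 ≤ y' →
      |divisorSum y * divisorSum y' - divisorMain y * divisorMain y'| ≤
        C * (C + C') * (y ^ β * y' ^ (1 + δ) + y ^ β * y' ^ (1 - δ) +
          (y ^ (1 + δ) * y' ^ β + y ^ (1 - δ) * y' ^ β)) := by
    intro y y' hy hy'
    -- `D D' - M M' = Δ D' + M Δ'`, so each product contains one `Δ`.
    have e : divisorSum y * divisorSum y' - divisorMain y * divisorMain y' =
        divisorError y * divisorSum y' + divisorMain y * divisorError y' := by
      rw [divisorSum_eq y, divisorSum_eq y']; ring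
    have h1 := mul_le_mul (hC y hy) (hD y' hy') (abs_nonneg _) (by positivity)
    have h2 := mul_le_mul (hC' y hy) (hC y' hy') (abs_nonneg _) (by positivity)
    rw [← abs_mul] at h1 h2
    have h3 : C' * (y ^ (1 + δ) + y ^ (1 - δ)) * (C * y' ^ β) ≤
        (C + C') * (y ^ (1 + δ) + y ^ (1 - δ)) * (C * y' ^ β) := by
      gcongr
      linarith
    rw [e]
    refine (abs_add_le _ _).trans ((add_le_add h1 (h2.trans h3)).trans (le_of_eq ?_))
    ring
  set K : ℝ → ℝ → ℝ := fun a b =>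
    ∑' t, |(weight t : ℝ)| / ((indexOne t : ℝ) ^ a * (indexTwo t : ℝ) ^ b) with hK
  have hmaj : (fun x : ℝ => ∑' t, (weight t : ℝ) *
      (divisorSum (x / indexOne t) * divisorSum (x / indexTwo t) -
        divisorMain (x / indexOne t) * divisorMain (x / indexTwo t))) =O[atTop]
      fun x : ℝ => x ^ (β + (1 + δ)) * K β (1 + δ) + x ^ (β + (1 - δ)) * K β (1 - δ) +
        (x ^ (1 + δ + β) * K (1 + δ) β + x ^ (1 - δ + β) * K (1 - δ) β) := by
    refine IsBigO.of_bound (C * (C + C')) ?_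
    filter_upwards [eventually_gt_atTop 0] with x hx
    have s1 := hasSum_abs_weight_mul (α := β) (β := 1 + δ) (x := x) hβ0 (by linarith)
      (by linarith) hx
    have s2 := hasSum_abs_weight_mul (α := β) (β := 1 - δ) (x := x) hβ0 (by linarith)
      (by linarith) hx
    have s3 := hasSum_abs_weight_mul (α := 1 + δ) (β := β) (x := x) (by linarith) hβ0
      (by linarith) hx
    have s4 := hasSum_abs_weight_mul (α := 1 - δ) (β := β) (x := x) (by linarith) hβ0
      (by linarith) hx
    have s := ((s1.add s2).add (s3.add s4)).mul_left (C * (C + C'))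
    refine (tsum_of_norm_bounded s fun t => ?_).trans ?_
    · rw [norm_mul, Real.norm_eq_abs, Real.norm_eq_abs]
      refine (mul_le_mul_of_nonneg_left (hterm (x / indexOne t) (x / indexTwo t) (by positivity)
        (by positivity)) (abs_nonneg _)).trans (le_of_eq ?_)
      ring
    · refine mul_le_mul_of_nonneg_left (le_abs_self _) (by positivity)
  refine hmaj.trans ((IsBigO.add ?_ ?_).add (IsBigO.add ?_ ?_)) <;>
    exact rpow_mul_isBigO (by linarith)

lemma divisorMain_div (x : ℝ) (hx : 0 < x) (r : ℕ) :
    divisorMain (x / r) = x / r *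
      (Real.log x + (2 * Real.eulerMascheroniConstant - 1) - Real.log r) := by
  rcases Nat.eq_zero_or_pos r with rfl | hr
  · simp [divisorMain]
  · rw [divisorMain, Real.log_div hx.ne' (by positivity)]
    ring

lemma abs_log_div_le (r : ℕ) : |Real.log r| / r ≤ 4 * (1 / (r : ℝ) ^ (3 / 4 : ℝ)) := by
  rcases Nat.eq_zero_or_pos r with rfl | hr
  · simp
  · have hr0 : (0 : ℝ) < r := by exact_mod_cast hr
    have h1 := Real.log_le_rpow_div hr0.le (show (0 : ℝ) < 1 / 4 by norm_num)
    rw [abs_of_nonneg (Real.log_nonneg (by exact_mod_cast hr)), div_le_iff₀ hr0]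
    have h2 : (r : ℝ) = (r : ℝ) ^ (3 / 4 : ℝ) * (r : ℝ) ^ (1 / 4 : ℝ) := by
      rw [← Real.rpow_add hr0]; norm_num
    have h3 : 0 < (r : ℝ) ^ (3 / 4 : ℝ) := by positivity
    calc Real.log r ≤ 4 * (r : ℝ) ^ (1 / 4 : ℝ) := by linarith
      _ = 4 * (1 / (r : ℝ) ^ (3 / 4 : ℝ)) * ((r : ℝ) ^ (3 / 4 : ℝ) * (r : ℝ) ^ (1 / 4 : ℝ)) := by
        field_simp
      _ = _ := by rw [← h2]

lemma one_div_le_rpow (r : ℕ) : (1 : ℝ) / r ≤ 1 / (r : ℝ) ^ (3 / 4 : ℝ) := by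
  rcases Nat.eq_zero_or_pos r with rfl | hr
  · simp
  · have hr0 : (1 : ℝ) ≤ r := by exact_mod_cast hr
    refine one_div_le_one_div_of_le (by positivity) ?_
    calc (r : ℝ) ^ (3 / 4 : ℝ) ≤ (r : ℝ) ^ (1 : ℝ) :=
          Real.rpow_le_rpow_of_exponent_le hr0 (by norm_num)
      _ = r := Real.rpow_one _

/-- The series `∑_t w(t) f(r(t)) g(s(t)) / (r(t) s(t))` converges for `f`, `g` of at most
logarithmic size. -/
lemma summable_weight_mul {f g : ℕ → ℝ} {c : ℝ} (hc : 0 ≤ c)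
    (hf : ∀ r, |f r| / r ≤ c * (1 / (r : ℝ) ^ (3 / 4 : ℝ)))
    (hg : ∀ r, |g r| / r ≤ c * (1 / (r : ℝ) ^ (3 / 4 : ℝ))) :
    Summable fun t => (weight t : ℝ) * ((f (indexOne t) / indexOne t) *
      (g (indexTwo t) / indexTwo t)) := by
  have h := (summable_abs_weight (α := 3 / 4) (β := 3 / 4) (by norm_num) (by norm_num)
    (by norm_num)).mul_left (c * c)
  refine Summable.of_norm_bounded h fun t => ?_
  rw [norm_mul, norm_mul, norm_div, norm_div]
  simp only [Real.norm_eq_abs, Nat.abs_cast]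
  refine (mul_le_mul_of_nonneg_left (mul_le_mul (hf (indexOne t)) (hg (indexTwo t)) (by positivity)
    (by positivity)) (abs_nonneg _)).trans (le_of_eq ?_)
  ring

/-- The main term of the sum over the weights. -/
lemma exists_hasSum_main : ∃ H₀ H₁ H₂ : ℝ, (H₀ : ℂ) = riemannZeta 2 / riemannZeta 3 ∧
    ∀ x : ℝ, 0 < x → HasSum (fun t => (weight t : ℝ) *
      (divisorMain (x / indexOne t) * divisorMain (x / indexTwo t)))
      (x ^ 2 * (H₀ * (Real.log x + (2 * Real.eulerMascheroniConstant - 1)) ^ 2 -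
        H₁ * (Real.log x + (2 * Real.eulerMascheroniConstant - 1)) + H₂)) := by
  have hone : ∀ r : ℕ, |(1 : ℝ)| / r ≤ 4 * (1 / (r : ℝ) ^ (3 / 4 : ℝ)) := by
    intro r
    have h := one_div_le_rpow r
    have : 0 ≤ 1 / (r : ℝ) ^ (3 / 4 : ℝ) := by positivity
    rw [abs_one]
    linarith
  obtain ⟨H₀, h0⟩ := summable_weight_mul (f := fun _ => 1) (g := fun _ => 1) (by norm_num) hone hone
  obtain ⟨H₁, h1⟩ := summable_weight_mul (f := fun r => Real.log r) (g := fun _ => 1) (by norm_num)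
    abs_log_div_le hone
  obtain ⟨H₁', h1'⟩ := summable_weight_mul (f := fun _ => 1) (g := fun r => Real.log r)
    (by norm_num) hone abs_log_div_le
  obtain ⟨H₂, h2⟩ := summable_weight_mul (f := fun r => Real.log r) (g := fun r => Real.log r)
    (by norm_num) abs_log_div_le abs_log_div_le
  refine ⟨H₀, H₁ + H₁', H₂, ?_, fun x hx => ?_⟩
  -- At `z = w = 1` the weight series is `ζ(2) ζ(3) / ζ(3)²`.
  · have hz := hasSum_weight (z := 1) (w := 1) (by simp) (by simp) (by norm_num)
    have hH : HasSum (fun t => (weight t : ℂ) / ((indexOne t : ℂ) ^ (1 : ℂ) *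
        (indexTwo t : ℂ) ^ (1 : ℂ))) (H₀ : ℂ) := by
      have e : ∀ t, (weight t : ℂ) / ((indexOne t : ℂ) ^ (1 : ℂ) * (indexTwo t : ℂ) ^ (1 : ℂ)) =
          (((weight t : ℝ) * (1 / (indexOne t : ℝ) * (1 / (indexTwo t : ℝ))) : ℝ) : ℂ) := by
        intro t
        rw [Complex.cpow_one, Complex.cpow_one]
        push_cast
        ring
      simp only [e]
      exact Complex.hasSum_ofReal.2 h0
    rw [hH.unique hz]
    have h3 : riemannZeta 3 ≠ 0 := riemannZeta_ne_zero_of_one_lt_re (by norm_num)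
    norm_num
    field_simp
  · set L := Real.log x + (2 * Real.eulerMascheroniConstant - 1) with hL
    have h := (((h0.mul_right (L ^ 2)).sub ((h1.add h1').mul_right L)).add h2).mul_left (x ^ 2)
    have e : ∀ t, (weight t : ℝ) *
        (divisorMain (x / indexOne t) * divisorMain (x / indexTwo t)) = x ^ 2 *
        ((weight t : ℝ) * (1 / (indexOne t : ℝ) * (1 / (indexTwo t : ℝ))) * L ^ 2 -
        ((weight t : ℝ) * (Real.log (indexOne t) / (indexOne t : ℝ) * (1 / (indexTwo t : ℝ))) +
        (weight t : ℝ) * (1 / (indexOne t : ℝ) * (Real.log (indexTwo t) / (indexTwo t : ℝ)))) * L +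
        (weight t : ℝ) * (Real.log (indexOne t) / (indexOne t : ℝ) *
          (Real.log (indexTwo t) / (indexTwo t : ℝ)))) := by
      intro t
      rw [divisorMain_div x hx, divisorMain_div x hx, ← hL]
      ring
    simp only [e]
    exact h

theorem sum_numSubrings_asymptotic : ∃ A₁ A₂ A₃ : ℝ, (A₁ : ℂ) = riemannZeta 2 / riemannZeta 3 ∧
    ∀ ε : ℝ, 0 < ε →
      (fun x : ℝ =>
        (∑ m ∈ Icc 1 ⌊x⌋₊, ∑ n ∈ Icc 1 ⌊x⌋₊, (numSubrings m n : ℝ)) -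
          x ^ 2 * (A₁ * Real.log x ^ 2 + A₂ * Real.log x + A₃))
        =O[atTop] fun x : ℝ => x ^ (1 + divisorExponent + ε) := by
  obtain ⟨H₀, H₁, H₂, h0, hmain⟩ := exists_hasSum_main
  set c := 2 * Real.eulerMascheroniConstant - 1 with hc
  -- Coefficients of `H₀ (log x + c)² - H₁ (log x + c) + H₂` as a polynomial in `log x`.
  refine ⟨H₀, 2 * c * H₀ - H₁, c ^ 2 * H₀ - c * H₁ + H₂, h0, fun ε hε => ?_⟩
  have hsmall : ∀ ε : ℝ, 0 < ε → ε < 1 / 2 → (fun x : ℝ =>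
        (∑ m ∈ Icc 1 ⌊x⌋₊, ∑ n ∈ Icc 1 ⌊x⌋₊, (numSubrings m n : ℝ)) -
          x ^ 2 * (H₀ * Real.log x ^ 2 + (2 * c * H₀ - H₁) * Real.log x +
            (c ^ 2 * H₀ - c * H₁ + H₂)))
        =O[atTop] fun x : ℝ => x ^ (1 + divisorExponent + ε) := by
    intro ε hε hε1
    refine (isBigO_error hε hε1).congr' ?_ EventuallyEq.rfl
    filter_upwards [eventually_gt_atTop 0] with x hx
    have h := (hasSum_weight_divisorSum x).sub (hmain x hx)
    simp only [← mul_sub] at h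
    rw [h.tsum_eq]
    ring
  rcases lt_or_ge ε (1 / 2) with h | h
  · exact hsmall ε hε h
  -- For larger `ε` the bound with `ε = 1/4` is already stronger.
  · refine (hsmall (1 / 4) (by norm_num) (by norm_num)).trans ?_
    simpa using rpow_mul_isBigO (K := 1) (show 1 + divisorExponent + 1 / 4 ≤
      1 + divisorExponent + ε by linarith)

end Asymptotic

theorem mainTheorem5 :
    (∀ z w : ℂ, 1 < z.re → 1 < w.re →
      HasSum (fun p : ℕ+ × ℕ+ =>
          (numSubrings p.1 p.2 : ℂ) / (((p.1 : ℕ) : ℂ) ^ z * ((p.2 : ℕ) : ℂ) ^ w))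
        (riemannZeta z ^ 2 * riemannZeta w ^ 2 * riemannZeta (z + w) *
            riemannZeta (2 * z + 2 * w - 1) /
          (riemannZeta (z + 2 * w) * riemannZeta (2 * z + w)))) ∧
    (∃ A₁ A₂ A₃ : ℝ, (A₁ : ℂ) = riemannZeta 2 / riemannZeta 3 ∧
      ∀ ε : ℝ, 0 < ε →
        (fun x : ℝ =>
          (∑ m ∈ Finset.Icc 1 ⌊x⌋₊, ∑ n ∈ Finset.Icc 1 ⌊x⌋₊, (numSubrings m n : ℝ)) -
            x ^ 2 * (A₁ * Real.log x ^ 2 + A₂ * Real.log x + A₃))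
          =O[atTop] fun x : ℝ => x ^ (1 + divisorExponent + ε)) :=
  ⟨fun _ _ hz hw => hasSum_numSubrings hz hw, sum_numSubrings_asymptotic⟩
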